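/- Let $\mathbb R^2_+=\{(x_1,x_2)\in\mathbb R^2:\ x_2>0\}$, $s=\{(x_1,0):\ |x_1|\ge 1\}$, $\Gamma_1=(-1,1)\times\{0\}$, let $\nu=(0,-1)$ be the outer unit normal on $\partial\mathbb R^2_+$, and let $\psi_k(r\cos t,r\sin t)=r^k\sin(kt)$ for $r\ge 0$, $t\in[0,\pi]$. Let $\mathcal Q$ be the completion of $C^\infty_{\rm c}(\overline{\mathbb R^2_+}\setminus s)$ (real-valued functions) under the norm $\left(\int_{\mathbb R^2_+}|\nabla u|^2\,dx\right)^{1/2}$. By Hardy's inequality $\mathcal Q$ is a space of functions on $\mathbb R^2_+$ (modulo equality almost everywhere), the limit of a Cauchy sequence of test functions being its limit in $L^2_{\rm loc}(\mathbb R^2_+)$. For every integer $k\ge 1$, the problem $$-\Delta w=0\ \text{ in }\mathbb R^2_+,\qquad w=0\ \text{ on } s,\qquad \frac{\partial w}{\partial\nu}=-\frac{\partial\psi_k}{\partial\nu}\ \text{ on }\Gamma_1$$ has a unique weak solution $w_k$ in $\mathcal Q$, where $w\in\mathcal Q$ is a weak solution if $$\int_{\mathbb R^2_+}\nabla w\cdot\nabla\varphi\,dx=-\int_{-1}^{1}\frac{\partial\psi_k}{\partial\nu}(x_1,0)\,\varphi(x_1,0)\,dx_1\qquad\text{for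 all }\varphi\in C^\infty_{\rm c}(\overline{\mathbb R^2_+}\setminus s).$$ In the elliptic coordinates $$F(\xi,\eta)=(\cosh\xi\cos\eta,\ \sinh\xi\sin\eta),\qquad (\xi,\eta)\in D=(0,+\infty)\times(0,\pi),$$ this solution is given (up to the choice of a representative) by $w_k\circ F=W_k$ on $D$, where $$W_k(\xi,\eta)=\frac1{2^{k-1}}\sum_{j=0}^{\left\lfloor\frac{k-1}{2}\right\rfloor}\binom kj\,e^{-(k-2j)\xi}\,\sin\big((k-2j)\eta\big).$$ -/

import Mathlib

open MeasureTheory Filter Topology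
open scoped ContDiff

noncomputable section

namespace EllipticProfile

/-- The open upper half-plane `ℝ²₊ = {x₂ > 0}`. -/
def halfPlane : Set (ℝ × ℝ) := {x | 0 < x.2}

/-- The union of half-lines `s = {x₂ = 0, x₁ ≥ 1 or x₁ ≤ -1}`. -/
def slit : Set (ℝ × ℝ) := {x | x.2 = 0 ∧ (1 ≤ x.1 ∨ x.1 ≤ -1)}

/-- First partial derivative of a function on the plane. -/
def d1 (φ : ℝ × ℝ → ℝ) (x : ℝ × ℝ) : ℝ := fderiv ℝ φ x (1, 0)

/-- Second partial derivative of a function on the plane. -/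
def d2 (φ : ℝ × ℝ → ℝ) (x : ℝ × ℝ) : ℝ := fderiv ℝ φ x (0, 1)

/-- The functions of `C_c^∞(closure ℝ²₊ ∖ s)`, each represented by an extension in
`C_c^∞(ℝ² ∖ s)`: smooth up to `{x₂ = 0}`, free on `Γ₁ = (-1, 1) × {0}`, zero near `s`. -/
structure IsTest (φ : ℝ × ℝ → ℝ) : Prop where
  smooth : ContDiff ℝ ∞ φ
  compact_support : HasCompactSupport φ
  disjoint_slit : Disjoint (tsupport φ) slit

/-- `(g₁, g₂)` is the weak (distributional) gradient of `u` on `ℝ²₊` and lies in `L²(ℝ²₊)`. -/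
structure HasWeakGradient (u g₁ g₂ : ℝ × ℝ → ℝ) : Prop where
  locallyIntegrable : LocallyIntegrableOn u halfPlane
  memLp_fst : MemLp g₁ 2 (volume.restrict halfPlane)
  memLp_snd : MemLp g₂ 2 (volume.restrict halfPlane)
  integral_fst : ∀ θ : ℝ × ℝ → ℝ, ContDiff ℝ ∞ θ → HasCompactSupport θ →
    tsupport θ ⊆ halfPlane →
    ∫ x in halfPlane, u x * d1 θ x = -∫ x in halfPlane, g₁ x * θ x
  integral_snd : ∀ θ : ℝ × ℝ → ℝ, ContDiff ℝ ∞ θ → HasCompactSupport θ →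
    tsupport θ ⊆ halfPlane →
    ∫ x in halfPlane, u x * d2 θ x = -∫ x in halfPlane, g₂ x * θ x

/-- `u` belongs to the space `𝒬`, the completion of `C_c^∞(closure ℝ²₊ ∖ s)` under the norm
`(∫_{ℝ²₊} |∇u|²)^{1/2}`, realised as a space of functions on `ℝ²₊` (modulo null sets), and
`(g₁, g₂)` is its gradient. By the Hardy inequality, a sequence of test functions that is Cauchy
for this norm converges in `L²_loc(ℝ²₊)`, and its limit in the completion is identified with that
function. -/
def MemQ (u g₁ g₂ : ℝ × ℝ → ℝ) : Prop :=
  HasWeakGradient u g₁ g₂ ∧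
  ∃ φ : ℕ → ℝ × ℝ → ℝ, (∀ n, IsTest (φ n)) ∧
    Tendsto (fun n => eLpNorm (fun x => d1 (φ n) x - g₁ x) 2 (volume.restrict halfPlane))
      atTop (𝓝 0) ∧
    Tendsto (fun n => eLpNorm (fun x => d2 (φ n) x - g₂ x) 2 (volume.restrict halfPlane))
      atTop (𝓝 0) ∧
    ∀ K : Set (ℝ × ℝ), IsCompact K → K ⊆ halfPlane →
      Tendsto (fun n => eLpNorm (fun x => φ n x - u x) 2 (volume.restrict K)) atTop (𝓝 0)

/-- `ψ_k(r cos t, r sin t) = r^k sin (k t)` for `t ∈ [0, π]`: in the closed upper half-plane,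
`t = arg (x₁ + i x₂)`. -/
def psi (k : ℕ) (x : ℝ × ℝ) : ℝ :=
  ‖(⟨x.1, x.2⟩ : ℂ)‖ ^ k * Real.sin (k * Complex.arg ⟨x.1, x.2⟩)

/-- The outer normal derivative `∂ψ_k/∂ν` at `(t, 0)`, where `ν = (0, -1)`. It is the one-sided
derivative, since `ψ_k` is a function on the closed upper half-plane. -/
def normalDerivPsi (k : ℕ) (t : ℝ) : ℝ :=
  -derivWithin (fun y : ℝ => psi k (t, y)) (Set.Ici 0) 0

/-- `w` is a `𝒬`-weak solution of `-Δw = 0` in `ℝ²₊`, `w = 0` on `s`,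
`∂w/∂ν = -∂ψ_k/∂ν` on `Γ₁ = (-1, 1) × {0}`. The condition on `s` is part of `w ∈ 𝒬`; the other
two are tested against the functions that are dense in `𝒬` by definition. -/
def IsWeakSolution (k : ℕ) (w : ℝ × ℝ → ℝ) : Prop :=
  ∃ g₁ g₂ : ℝ × ℝ → ℝ, MemQ w g₁ g₂ ∧
    ∀ φ : ℝ × ℝ → ℝ, IsTest φ →
      ∫ x in halfPlane, (g₁ x * d1 φ x + g₂ x * d2 φ x)
        = ∫ t in (-1 : ℝ)..1, -normalDerivPsi k t * φ (t, 0)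

/-- Elliptic coordinates, `p = (ξ, η)`. -/
def F (p : ℝ × ℝ) : ℝ × ℝ :=
  (Real.cosh p.1 * Real.cos p.2, Real.sinh p.1 * Real.sin p.2)

/-- The domain `D = (0, ∞) × (0, π)` of the coordinates of the upper half-plane. -/
def D : Set (ℝ × ℝ) := Set.Ioi 0 ×ˢ Set.Ioo 0 Real.pi

/-- The finite sum `W_k(ξ, η)`, `p = (ξ, η)`. -/
def W (k : ℕ) (p : ℝ × ℝ) : ℝ :=
  1 / 2 ^ (k - 1) * ∑ j ∈ Finset.range ((k - 1) / 2 + 1),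
    (k.choose j : ℝ) * Real.exp (-((k : ℝ) - 2 * j) * p.1) * Real.sin (((k : ℝ) - 2 * j) * p.2)

end EllipticProfile

end

/-!
The elliptic coordinates `F (ξ, η)`, the real form of `cosh (ξ + iη)`, map the strip `ℝ × (0, π)`
diffeomorphically onto the plane slit along `s`, and `D` onto the half-plane. The inverse is
explicit (`ellipticInv`): half the difference of the distances to the foci `(±1, 0)` is `cos η`. Hence test
functions on the slit plane are the same as smooth functions with compact support in the strip
(`isTest_comp_ellipticInv`, `IsTest.exists_compact`), and since `F` is conformal the Dirichlet form
on the half-plane is the Dirichlet form on `D` (`integral_dirichlet_comp_F`,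
`lintegral_energy_comp_F`).

Existence. `W k` is a finite sum of harmonic modes `e^{-mξ} sin (mη)` with `m ≥ 1`. It vanishes
linearly at `η = 0, π` and decays with its gradient like `e^{-ξ}`, so cutting it off in the strip
costs arbitrarily little energy (`tendsto_energy_cutoff_error`), and `W k ∘ F⁻¹` lies in `𝒬`. By
Green's formula on `D` (`integral_dirichlet_sinSum`) its Dirichlet product with a test function
reduces to the side `ξ = 0`, where `-∂W/∂ξ = k cos^{k-1} η sin η` (differentiate the expansion
of `cos^k` in multiple angles, `mul_cos_pow_mul_sin`). The substitution `t = cos η` turns this into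
the datum `-∂ψ_k/∂ν = k t^{k-1}` on `Γ₁`.

Uniqueness. The gradient `G` of the difference of two solutions is orthogonal to all gradients of
test functions and is a limit of such gradients `∇φ_n`. By Pythagoras `‖∇φ_n‖ ≤ ‖∇φ_n - G‖ → 0`, and a
Poincaré inequality (`exists_poincare`), obtained by integrating along oblique segments that end on
the slit, gives `φ_n → 0` in `L²_loc`, so the two solutions agree.
-/

noncomputable section

namespace EllipticProfile

/-! ### Elliptic coordinates on the slit plane -/

/-- The strip `ℝ × (0, π)`, on which `F` is a diffeomorphism onto the slit plane `ℝ² ∖ s`. -/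
def strip : Set (ℝ × ℝ) := {p | 0 < p.2 ∧ p.2 < Real.pi}

/-- Half the difference of the distances from `x` to the foci `(-1, 0)` and `(1, 0)`.
In elliptic coordinates it equals `cos η`. -/
def focal (x : ℝ × ℝ) : ℝ :=
  (√((x.1 + 1) ^ 2 + x.2 ^ 2) - √((x.1 - 1) ^ 2 + x.2 ^ 2)) / 2

/-- The inverse of elliptic coordinates on the slit plane. On the slit itself the second component
is `0` or `π`, the boundary values of the strip. -/
def ellipticInv (x : ℝ × ℝ) : ℝ × ℝ :=
  (Real.arsinh (x.2 / √(1 - focal x ^ 2)), Real.arccos (focal x))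

lemma isOpen_strip : IsOpen strip :=
  (isOpen_lt continuous_const continuous_snd).inter (isOpen_lt continuous_snd continuous_const)

lemma isOpen_halfPlane : IsOpen halfPlane := isOpen_lt continuous_const continuous_snd

lemma isOpen_D : IsOpen D := isOpen_Ioi.prod isOpen_Ioo

lemma measurableSet_D : MeasurableSet D := isOpen_D.measurableSet

lemma measurableSet_halfPlane : MeasurableSet halfPlane := isOpen_halfPlane.measurableSet

lemma D_subset_strip : D ⊆ strip := fun _ hp => hp.2

lemma halfPlane_subset_compl_slit : halfPlane ⊆ slitᶜ := fun x hx hs => by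
  have h1 : 0 < x.2 := hx
  exact h1.ne' hs.1

lemma contDiff_F : ContDiff ℝ ∞ F :=
  ((Real.contDiff_cosh.comp contDiff_fst).mul (Real.contDiff_cos.comp contDiff_snd)).prodMk
    ((Real.contDiff_sinh.comp contDiff_fst).mul (Real.contDiff_sin.comp contDiff_snd))

lemma sin_pos_of_mem_strip {p : ℝ × ℝ} (hp : p ∈ strip) : 0 < Real.sin p.2 :=
  Real.sin_pos_of_pos_of_lt_pi hp.1 hp.2

/-- The focal distances of `F p` are `cosh ξ ± cos η`. -/
lemma focal_F (p : ℝ × ℝ) : focal (F p) = Real.cos p.2 := by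
  have hc := Real.one_le_cosh p.1
  have h1 := Real.neg_one_le_cos p.2
  have h2 := Real.cos_le_one p.2
  have hs := Real.sin_sq_add_cos_sq p.2
  have hh := Real.cosh_sq p.1
  have e1 : ((F p).1 + 1) ^ 2 + (F p).2 ^ 2 = (Real.cosh p.1 + Real.cos p.2) ^ 2 := by
    simp only [F]
    linear_combination (Real.sinh p.1 ^ 2) * hs + (-1 + Real.cos p.2 ^ 2) * hh
  have e2 : ((F p).1 - 1) ^ 2 + (F p).2 ^ 2 = (Real.cosh p.1 - Real.cos p.2) ^ 2 := by
    simp only [F]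
    linear_combination (Real.sinh p.1 ^ 2) * hs + (-1 + Real.cos p.2 ^ 2) * hh
  rw [focal, e1, e2, Real.sqrt_sq (by linarith), Real.sqrt_sq (by linarith)]
  ring

lemma ellipticInv_F {p : ℝ × ℝ} (hp : p ∈ strip) : ellipticInv (F p) = p := by
  have hs := sin_pos_of_mem_strip hp
  have e : 1 - Real.cos p.2 ^ 2 = Real.sin p.2 ^ 2 := by
    linarith [Real.sin_sq_add_cos_sq p.2]
  refine Prod.ext ?_ ?_
  · simp only [ellipticInv, focal_F, e, Real.sqrt_sq hs.le]
    simp only [F]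
    rw [mul_div_cancel_right₀ _ hs.ne', Real.arsinh_sinh]
  · simp only [ellipticInv, focal_F]
    exact Real.arccos_cos hp.1.le hp.2.le

lemma F_notMem_slit {p : ℝ × ℝ} (hp : p ∈ strip) : F p ∉ slit := by
  rintro ⟨h0, h1⟩
  have hs := sin_pos_of_mem_strip hp
  have hξ : p.1 = 0 := by
    have := (mul_eq_zero.1 h0).resolve_right hs.ne'
    simpa using this
  have hsq := Real.sin_sq_add_cos_sq p.2
  simp only [F, hξ, Real.cosh_zero, one_mul] at h1
  rcases h1 with h1 | h1 <;> nlinarith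

/-- The classical relations between a point and `a = cosh ξ`, `b = cos η`, half the sum and half
the difference of its focal distances. -/
lemma exists_focal_sum (x : ℝ × ℝ) :
    ∃ a : ℝ, 1 ≤ a ∧ a * focal x = x.1 ∧ (a ^ 2 - 1) * (1 - focal x ^ 2) = x.2 ^ 2 ∧
      -1 ≤ focal x ∧ focal x ≤ 1 := by
  have hP := Real.sq_sqrt (show 0 ≤ (x.1 + 1) ^ 2 + x.2 ^ 2 by positivity)
  have hM := Real.sq_sqrt (show 0 ≤ (x.1 - 1) ^ 2 + x.2 ^ 2 by positivity)
  have p1 : x.1 + 1 ≤ √((x.1 + 1) ^ 2 + x.2 ^ 2) :=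
    Real.le_sqrt_of_sq_le (by nlinarith [sq_nonneg x.2])
  have p2 : -(x.1 + 1) ≤ √((x.1 + 1) ^ 2 + x.2 ^ 2) :=
    Real.le_sqrt_of_sq_le (by nlinarith [sq_nonneg x.2])
  have m1 : x.1 - 1 ≤ √((x.1 - 1) ^ 2 + x.2 ^ 2) :=
    Real.le_sqrt_of_sq_le (by nlinarith [sq_nonneg x.2])
  have m2 : -(x.1 - 1) ≤ √((x.1 - 1) ^ 2 + x.2 ^ 2) :=
    Real.le_sqrt_of_sq_le (by nlinarith [sq_nonneg x.2])
  have n1 := Real.sqrt_nonneg ((x.1 + 1) ^ 2 + x.2 ^ 2)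
  have n2 := Real.sqrt_nonneg ((x.1 - 1) ^ 2 + x.2 ^ 2)
  simp only [focal]
  generalize √((x.1 + 1) ^ 2 + x.2 ^ 2) = P at *
  generalize √((x.1 - 1) ^ 2 + x.2 ^ 2) = M at *
  refine ⟨(P + M) / 2, by linarith, ?_, ?_, ?_, ?_⟩
  · linear_combination hP / 4 - hM / 4
  · have h : P ^ 2 - M ^ 2 = 4 * x.1 := by linear_combination hP - hM
    linear_combination hP / 2 + hM / 2 - (P ^ 2 - M ^ 2 + 4 * x.1) * h / 16
  · nlinarith
  · nlinarith

lemma focal_sq_lt_one {x : ℝ × ℝ} (hx : x ∉ slit) : focal x ^ 2 < 1 := by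
  obtain ⟨a, ha, h1, h2, h3, h4⟩ := exists_focal_sum x
  by_contra! h
  have hb : focal x ^ 2 = 1 := le_antisymm (by nlinarith) h
  have h0 : x.2 = 0 := by
    rw [hb] at h2
    simpa using h2.symm
  refine hx ⟨h0, ?_⟩
  rcases (by simpa using hb : focal x = 1 ∨ focal x = -1) with h | h <;> rw [h] at h1
  · left; linarith
  · right; linarith

lemma focal_eq_one_or_neg_one {x : ℝ × ℝ} (hx : x ∈ slit) : focal x = 1 ∨ focal x = -1 := by
  simp only [focal, hx.1]
  rcases hx.2 with h | h
  · left
    rw [zero_pow two_ne_zero, add_zero, add_zero, Real.sqrt_sq (by linarith),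
      Real.sqrt_sq (by linarith)]
    ring
  · right
    rw [zero_pow two_ne_zero, add_zero, add_zero, Real.sqrt_sq_eq_abs, Real.sqrt_sq_eq_abs,
      abs_of_nonpos (by linarith), abs_of_nonpos (by linarith)]
    ring

lemma sin_ellipticInv_of_mem_slit {x : ℝ × ℝ} (hx : x ∈ slit) :
    Real.sin (ellipticInv x).2 = 0 := by
  simp only [ellipticInv]
  rcases focal_eq_one_or_neg_one hx with h | h <;> simp [h]

lemma ellipticInv_mem_strip {x : ℝ × ℝ} (hx : x ∉ slit) : ellipticInv x ∈ strip := by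
  have h := focal_sq_lt_one hx
  obtain ⟨h1, h2⟩ := abs_lt.1 ((sq_lt_one_iff_abs_lt_one _).1 h)
  refine ⟨Real.arccos_pos.2 h2, ?_⟩
  refine lt_of_le_of_ne (Real.arccos_le_pi _) fun h' => ?_
  have := Real.arccos_eq_pi.1 h'
  linarith

lemma F_ellipticInv {x : ℝ × ℝ} (hx : x ∉ slit) : F (ellipticInv x) = x := by
  have h := focal_sq_lt_one hx
  obtain ⟨a, ha, h1, h2, h3, h4⟩ := exists_focal_sum x
  have hpos : 0 < 1 - focal x ^ 2 := by linarith
  have hs := Real.sqrt_pos.2 hpos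
  refine Prod.ext ?_ ?_
  · simp only [F, ellipticInv, Real.cosh_arsinh, Real.cos_arccos h3 h4]
    have : 1 + (x.2 / √(1 - focal x ^ 2)) ^ 2 = a ^ 2 := by
      rw [div_pow, Real.sq_sqrt hpos.le, ← h2, mul_div_cancel_right₀ _ hpos.ne']
      ring
    rw [this, Real.sqrt_sq (by linarith), h1]
  · simp only [F, ellipticInv, Real.sinh_arsinh, Real.sin_arccos]
    field_simp

lemma contDiffAt_ellipticInv {x : ℝ × ℝ} (hx : x ∉ slit) : ContDiffAt ℝ ∞ ellipticInv x := by
  have h := focal_sq_lt_one hx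
  obtain ⟨h1, h2⟩ := abs_lt.1 ((sq_lt_one_iff_abs_lt_one _).1 h)
  have hfoc : ContDiffAt ℝ ∞ focal x := by
    unfold focal
    refine ContDiffAt.div_const (ContDiffAt.sub (ContDiffAt.sqrt (by fun_prop) ?_)
      (ContDiffAt.sqrt (by fun_prop) ?_)) 2
    · intro h0
      refine hx ⟨?_, Or.inr ?_⟩ <;> nlinarith [sq_nonneg (x.1 + 1), sq_nonneg x.2]
    · intro h0
      refine hx ⟨?_, Or.inl ?_⟩ <;> nlinarith [sq_nonneg (x.1 - 1), sq_nonneg x.2]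
  unfold ellipticInv
  refine ContDiffAt.prodMk (ContDiffAt.arsinh ?_) ?_
  · refine ContDiffAt.div contDiffAt_snd (ContDiffAt.sqrt (by fun_prop) (by linarith)) ?_
    exact (Real.sqrt_pos.2 (by linarith)).ne'
  · exact (Real.contDiffAt_arccos h1.ne' h2.ne).comp (f := focal) x hfoc

lemma continuousOn_ellipticInv : ContinuousOn ellipticInv slitᶜ := fun _ hx =>
  (contDiffAt_ellipticInv hx).continuousAt.continuousWithinAt

lemma F_mem_halfPlane {p : ℝ × ℝ} (hp : p ∈ D) : F p ∈ halfPlane :=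
  mul_pos (Real.sinh_pos_iff.2 hp.1) (sin_pos_of_mem_strip hp.2)

lemma ellipticInv_mem_D {x : ℝ × ℝ} (hx : x ∈ halfPlane) : ellipticInv x ∈ D := by
  have hs := halfPlane_subset_compl_slit hx
  refine ⟨?_, ellipticInv_mem_strip hs⟩
  have := focal_sq_lt_one hs
  exact Real.arsinh_pos_iff.2 (div_pos hx (Real.sqrt_pos.2 (by linarith)))

lemma image_F_D : F '' D = halfPlane := by
  refine Set.Subset.antisymm (Set.image_subset_iff.2 fun p hp => F_mem_halfPlane hp) fun x hx => ?_
  exact ⟨ellipticInv x, ellipticInv_mem_D hx, F_ellipticInv (halfPlane_subset_compl_slit hx)⟩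

lemma injOn_F : Set.InjOn F D := fun p hp q hq h => by
  rw [← ellipticInv_F (D_subset_strip hp), h, ellipticInv_F (D_subset_strip hq)]

/-! ### Test functions in elliptic coordinates -/

/-- A smooth function whose restriction to the strip has compact support there gives a test
function. It need not vanish elsewhere outside the strip, but it has to vanish on the boundary
lines, which are the values of `ellipticInv` on the slit. -/
lemma isTest_comp_ellipticInv {Φ : ℝ × ℝ → ℝ} (hΦ : ContDiff ℝ ∞ Φ) {K : Set (ℝ × ℝ)}
    (hK : IsCompact K) (hKs : K ⊆ strip) (hsupp : ∀ p ∈ strip, p ∉ K → Φ p = 0)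
    (h0 : ∀ p : ℝ × ℝ, Real.sin p.2 = 0 → Φ p = 0) :
    IsTest (fun x => Φ (ellipticInv x)) := by
  have hFK : IsCompact (F '' K) := hK.image contDiff_F.continuous
  have hzero : ∀ x ∉ F '' K, Φ (ellipticInv x) = 0 := fun x hx => by
    by_cases hs : x ∈ slit
    · exact h0 _ (sin_ellipticInv_of_mem_slit hs)
    · exact hsupp _ (ellipticInv_mem_strip hs) fun h => hx ⟨_, h, F_ellipticInv hs⟩
  have hFs : ∀ x ∈ F '' K, x ∉ slit := by
    rintro _ ⟨p, hp, rfl⟩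
    exact F_notMem_slit (hKs hp)
  have hts : tsupport (fun x => Φ (ellipticInv x)) ⊆ F '' K :=
    closure_minimal (fun x hx => by_contra fun h => hx (hzero x h)) hFK.isClosed
  refine ⟨contDiff_iff_contDiffAt.2 fun x => ?_, HasCompactSupport.intro hFK hzero,
    Set.disjoint_left.2 fun x hx => hFs x (hts hx)⟩
  by_cases hx : x ∈ slit
  · have : (fun x => Φ (ellipticInv x)) =ᶠ[𝓝 x] fun _ => 0 := by
      filter_upwards [hFK.isClosed.isOpen_compl.mem_nhds fun h => hFs x h hx] with y hy
      exact hzero y hy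
    exact contDiffAt_const.congr_of_eventuallyEq this
  · exact hΦ.contDiffAt.comp x (contDiffAt_ellipticInv hx)

/-- In elliptic coordinates a test function vanishes near the boundary of the strip and for
large `|ξ|`. -/
lemma IsTest.exists_compact {φ : ℝ × ℝ → ℝ} (hφ : IsTest φ) :
    ∃ K ⊆ strip, IsCompact K ∧ ∀ p ∈ strip, p ∉ K → φ (F p) = 0 := by
  have hsub : tsupport φ ⊆ slitᶜ := fun x hx => Set.disjoint_left.1 hφ.disjoint_slit hx
  refine ⟨ellipticInv '' tsupport φ, ?_,
    hφ.compact_support.isCompact.image_of_continuousOn (continuousOn_ellipticInv.mono hsub), ?_⟩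
  · rintro _ ⟨x, hx, rfl⟩
    exact ellipticInv_mem_strip (hsub hx)
  · intro p hp hpK
    by_contra h
    exact hpK ⟨F p, subset_tsupport _ h, ellipticInv_F hp⟩

/-! ### Conformal invariance of the Dirichlet form -/

/-- The derivative of `F`, a similarity of ratio `√(sinh² ξ + sin² η)`. -/
def derivF (p : ℝ × ℝ) : ℝ × ℝ →L[ℝ] ℝ × ℝ :=
  LinearMap.toContinuousLinearMap (Matrix.toLin (Module.Basis.finTwoProd ℝ)
    (Module.Basis.finTwoProd ℝ)
    !![Real.sinh p.1 * Real.cos p.2, -(Real.cosh p.1 * Real.sin p.2);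
      Real.cosh p.1 * Real.sin p.2, Real.sinh p.1 * Real.cos p.2])

lemma derivF_apply (p v : ℝ × ℝ) : derivF p v =
    (Real.sinh p.1 * Real.cos p.2 * v.1 + -(Real.cosh p.1 * Real.sin p.2) * v.2,
      Real.cosh p.1 * Real.sin p.2 * v.1 + Real.sinh p.1 * Real.cos p.2 * v.2) := by
  simp [derivF, Matrix.toLin_finTwoProd_apply]

lemma det_derivF (p : ℝ × ℝ) : (derivF p).det =
    (Real.sinh p.1 * Real.cos p.2) ^ 2 + (Real.cosh p.1 * Real.sin p.2) ^ 2 := by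
  rw [derivF, ContinuousLinearMap.det]
  simp only [LinearMap.coe_toContinuousLinearMap, LinearMap.det_toLin, Matrix.det_fin_two_of]
  ring

lemma hasFDerivAt_F (p : ℝ × ℝ) : HasFDerivAt F (derivF p) p := by
  have h1 : HasFDerivAt (fun p : ℝ × ℝ => Real.cosh p.1 * Real.cos p.2) _ p :=
    HasFDerivAt.mul (hasFDerivAt_fst.cosh) (hasFDerivAt_snd.cos)
  have h2 : HasFDerivAt (fun p : ℝ × ℝ => Real.sinh p.1 * Real.sin p.2) _ p :=
    HasFDerivAt.mul (hasFDerivAt_fst.sinh) (hasFDerivAt_snd.sin)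
  refine (h1.prodMk h2).congr_fderiv (ContinuousLinearMap.ext fun v => ?_)
  rw [derivF_apply]
  refine Prod.ext ?_ ?_ <;> simp <;> ring

lemma d1_comp_F {u : ℝ × ℝ → ℝ} {p : ℝ × ℝ} (hu : DifferentiableAt ℝ u (F p)) :
    d1 (fun q => u (F q)) p = Real.sinh p.1 * Real.cos p.2 * d1 u (F p) +
      Real.cosh p.1 * Real.sin p.2 * d2 u (F p) := by
  have h := (hu.hasFDerivAt.comp p (hasFDerivAt_F p)).fderiv
  have e : derivF p (1, 0) = (Real.sinh p.1 * Real.cos p.2) • ((1, 0) : ℝ × ℝ) +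
      (Real.cosh p.1 * Real.sin p.2) • ((0, 1) : ℝ × ℝ) := by
    rw [derivF_apply]; ext <;> simp
  change fderiv ℝ (u ∘ F) p (1, 0) = _
  rw [h, ContinuousLinearMap.comp_apply, e, map_add, map_smul, map_smul]
  rfl

lemma d2_comp_F {u : ℝ × ℝ → ℝ} {p : ℝ × ℝ} (hu : DifferentiableAt ℝ u (F p)) :
    d2 (fun q => u (F q)) p = -(Real.cosh p.1 * Real.sin p.2) * d1 u (F p) +
      Real.sinh p.1 * Real.cos p.2 * d2 u (F p) := by
  have h := (hu.hasFDerivAt.comp p (hasFDerivAt_F p)).fderiv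
  have e : derivF p (0, 1) = (-(Real.cosh p.1 * Real.sin p.2)) • ((1, 0) : ℝ × ℝ) +
      (Real.sinh p.1 * Real.cos p.2) • ((0, 1) : ℝ × ℝ) := by
    rw [derivF_apply]; ext <;> simp
  change fderiv ℝ (u ∘ F) p (0, 1) = _
  rw [h, ContinuousLinearMap.comp_apply, e, map_add, map_smul, map_smul]
  rfl

lemma d1_congr {u v : ℝ × ℝ → ℝ} {U : Set (ℝ × ℝ)} (hU : IsOpen U) (h : Set.EqOn u v U)
    {x : ℝ × ℝ} (hx : x ∈ U) : d1 u x = d1 v x := by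
  rw [d1, d1, (h.eventuallyEq_of_mem (hU.mem_nhds hx)).fderiv_eq]

lemma d2_congr {u v : ℝ × ℝ → ℝ} {U : Set (ℝ × ℝ)} (hU : IsOpen U) (h : Set.EqOn u v U)
    {x : ℝ × ℝ} (hx : x ∈ U) : d2 u x = d2 v x := by
  rw [d2, d2, (h.eventuallyEq_of_mem (hU.mem_nhds hx)).fderiv_eq]

/-- The Jacobian `sinh² ξ + sin² η` of `F` cancels the square of the dilation factor of the
gradients. -/
lemma integral_dirichlet_comp_F {u v : ℝ × ℝ → ℝ}
    (hu : ∀ x ∈ halfPlane, DifferentiableAt ℝ u x) (hv : ∀ x ∈ halfPlane, DifferentiableAt ℝ v x) :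
    ∫ x in halfPlane, (d1 u x * d1 v x + d2 u x * d2 v x) =
      ∫ p in D, (d1 (fun q => u (F q)) p * d1 (fun q => v (F q)) p +
        d2 (fun q => u (F q)) p * d2 (fun q => v (F q)) p) := by
  rw [← image_F_D, integral_image_eq_integral_abs_det_fderiv_smul volume measurableSet_D
    (fun p _ => (hasFDerivAt_F p).hasFDerivWithinAt) injOn_F]
  refine setIntegral_congr_fun measurableSet_D fun p hp => ?_
  have h := F_mem_halfPlane hp
  simp only [det_derivF, d1_comp_F (hu _ h), d2_comp_F (hu _ h), d1_comp_F (hv _ h),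
    d2_comp_F (hv _ h), smul_eq_mul]
  rw [abs_of_nonneg (by positivity)]
  ring

lemma lintegral_energy_comp_F {u : ℝ × ℝ → ℝ}
    (hu : ∀ x ∈ halfPlane, DifferentiableAt ℝ u x) :
    ∫⁻ x in halfPlane, ENNReal.ofReal (d1 u x ^ 2 + d2 u x ^ 2) =
      ∫⁻ p in D, ENNReal.ofReal (d1 (fun q => u (F q)) p ^ 2 + d2 (fun q => u (F q)) p ^ 2) := by
  rw [← image_F_D, lintegral_image_eq_lintegral_abs_det_fderiv_mul volume measurableSet_D
    (fun p _ => (hasFDerivAt_F p).hasFDerivWithinAt) injOn_F]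
  refine setLIntegral_congr_fun measurableSet_D fun p hp => ?_
  have h := F_mem_halfPlane hp
  simp only [det_derivF, d1_comp_F (hu _ h), d2_comp_F (hu _ h)]
  rw [← ENNReal.ofReal_mul (abs_nonneg _), abs_of_nonneg (by positivity)]
  congr 1
  ring

/-! ### Square-integrable gradients and the Poincaré inequality -/

lemma eLpNorm_two_sq {α : Type*} [MeasurableSpace α] (f : α → ℝ) (μ : Measure α) :
    eLpNorm f 2 μ ^ 2 = ∫⁻ x, ENNReal.ofReal (f x ^ 2) ∂μ := by
  have h := eLpNorm_nnreal_pow_eq_lintegral (f := f) (μ := μ) (p := 2) two_ne_zero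
  simp only [NNReal.coe_ofNat, ENNReal.rpow_ofNat, ENNReal.coe_ofNat] at h
  rw [h]
  refine lintegral_congr fun x => ?_
  rw [← Real.enorm_abs, Real.enorm_of_nonneg (abs_nonneg _), ← ENNReal.ofReal_pow (abs_nonneg _),
    sq_abs]

lemma tendsto_zero_of_sq {u : ℕ → ENNReal} (h : Tendsto (fun n => u n ^ 2) atTop (𝓝 0)) :
    Tendsto u atTop (𝓝 0) := by
  have := (ENNReal.continuous_rpow_const (y := (1 / 2 : ℝ))).tendsto 0 |>.comp h
  rw [ENNReal.zero_rpow_of_pos (by norm_num)] at this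
  refine this.congr fun n => ?_
  simp only [Function.comp]
  rw [← ENNReal.rpow_natCast, ← ENNReal.rpow_mul]
  norm_num

lemma tendsto_sq_zero {u : ℕ → ENNReal} (h : Tendsto u atTop (𝓝 0)) :
    Tendsto (fun n => u n ^ 2) atTop (𝓝 0) := by
  simpa [Function.comp_def] using ((ENNReal.continuous_pow 2).tendsto 0).comp h

lemma lintegral_ofReal_sq_add_sq {f g : ℝ × ℝ → ℝ} {μ : Measure (ℝ × ℝ)}
    (hf : AEStronglyMeasurable f μ) :
    ∫⁻ x, ENNReal.ofReal (f x ^ 2 + g x ^ 2) ∂μ = eLpNorm f 2 μ ^ 2 + eLpNorm g 2 μ ^ 2 := by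
  rw [eLpNorm_two_sq, eLpNorm_two_sq, ← lintegral_add_left']
  · exact lintegral_congr fun x => ENNReal.ofReal_add (sq_nonneg _) (sq_nonneg _)
  · exact (hf.aemeasurable.pow_const 2).ennreal_ofReal

lemma IsTest.differentiable {φ : ℝ × ℝ → ℝ} (hφ : IsTest φ) : Differentiable ℝ φ :=
  hφ.smooth.differentiable (by simp)

lemma continuous_d1 {φ : ℝ × ℝ → ℝ} (hφ : ContDiff ℝ ∞ φ) : Continuous (d1 φ) :=
  (hφ.continuous_fderiv (by simp)).clm_apply continuous_const

lemma continuous_d2 {φ : ℝ × ℝ → ℝ} (hφ : ContDiff ℝ ∞ φ) : Continuous (d2 φ) :=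
  (hφ.continuous_fderiv (by simp)).clm_apply continuous_const

lemma hasCompactSupport_d1 {φ : ℝ × ℝ → ℝ} (hφ : HasCompactSupport φ) :
    HasCompactSupport (d1 φ) := hφ.fderiv_apply ℝ (1, 0)

lemma hasCompactSupport_d2 {φ : ℝ × ℝ → ℝ} (hφ : HasCompactSupport φ) :
    HasCompactSupport (d2 φ) := hφ.fderiv_apply ℝ (0, 1)

lemma IsTest.memLp_d1 {φ : ℝ × ℝ → ℝ} (hφ : IsTest φ) :
    MemLp (d1 φ) 2 (volume.restrict halfPlane) :=
  ((continuous_d1 hφ.smooth).memLp_of_hasCompactSupport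
    (hasCompactSupport_d1 hφ.compact_support)).restrict _

lemma IsTest.memLp_d2 {φ : ℝ × ℝ → ℝ} (hφ : IsTest φ) :
    MemLp (d2 φ) 2 (volume.restrict halfPlane) :=
  ((continuous_d2 hφ.smooth).memLp_of_hasCompactSupport
    (hasCompactSupport_d2 hφ.compact_support)).restrict _

lemma IsTest.sub {φ ψ : ℝ × ℝ → ℝ} (hφ : IsTest φ) (hψ : IsTest ψ) :
    IsTest (fun x => φ x - ψ x) := by
  refine ⟨hφ.smooth.sub hψ.smooth, hφ.compact_support.sub hψ.compact_support, ?_⟩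
  exact (hφ.disjoint_slit.union_left hψ.disjoint_slit).mono_left (tsupport_sub φ ψ)

lemma d1_sub {φ ψ : ℝ × ℝ → ℝ} {x : ℝ × ℝ} (hφ : DifferentiableAt ℝ φ x)
    (hψ : DifferentiableAt ℝ ψ x) : d1 (fun x => φ x - ψ x) x = d1 φ x - d1 ψ x := by
  simp only [d1]
  rw [fderiv_fun_sub hφ hψ, _root_.sub_apply]

lemma d2_sub {φ ψ : ℝ × ℝ → ℝ} {x : ℝ × ℝ} (hφ : DifferentiableAt ℝ φ x)
    (hψ : DifferentiableAt ℝ ψ x) : d2 (fun x => φ x - ψ x) x = d2 φ x - d2 ψ x := by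
  simp only [d2]
  rw [fderiv_fun_sub hφ hψ, _root_.sub_apply]

/-- Cauchy–Schwarz on an interval, against the constant function `1`. -/
lemma sq_integral_le {f : ℝ → ℝ} (hf : Continuous f) {L : ℝ} (hL : 0 < L) :
    (∫ t in 0..L, f t) ^ 2 ≤ L * ∫ t in 0..L, f t ^ 2 := by
  set I := ∫ t in 0..L, f t with hI
  -- The variance of `f` about its mean `I / L`, scaled by `L ^ 2` to avoid division.
  have h0 : 0 ≤ ∫ t in 0..L, (L * f t - I) ^ 2 :=
    intervalIntegral.integral_nonneg hL.le fun t _ => sq_nonneg _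
  have h1 : ∫ t in 0..L, (L * f t - I) ^ 2 =
      L ^ 2 * (∫ t in 0..L, f t ^ 2) - 2 * L * I * I + L * I ^ 2 := by
    have : ∀ t, (L * f t - I) ^ 2 = L ^ 2 * f t ^ 2 - 2 * L * I * f t + I ^ 2 := fun t => by ring
    simp only [this]
    rw [intervalIntegral.integral_add, intervalIntegral.integral_sub,
      intervalIntegral.integral_const_mul, intervalIntegral.integral_const_mul,
      intervalIntegral.integral_const, ← hI]
    · simp
    all_goals exact Continuous.intervalIntegrable (by fun_prop) _ _
  rw [h1] at h0
  have h2 : 0 ≤ L * (L * (∫ t in 0..L, f t ^ 2) - I ^ 2) := by linarith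
  linarith [nonneg_of_mul_nonneg_right h2 hL]

/-- A test function is controlled by its gradient along a segment that ends on the slit. -/
lemma IsTest.sq_le {φ : ℝ × ℝ → ℝ} (hφ : IsTest φ) {x : ℝ × ℝ} (hx : 0 < x.2) {a : ℝ}
    (ha : 1 ≤ x.1 + a * x.2) :
    φ x ^ 2 ≤ x.2 * ((1 + a ^ 2) * ∫ t in 0..x.2,
      (d1 φ (x + t • ((a, -1) : ℝ × ℝ)) ^ 2 + d2 φ (x + t • ((a, -1) : ℝ × ℝ)) ^ 2)) := by
  have c1 := continuous_d1 hφ.smooth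
  have c2 := continuous_d2 hφ.smooth
  have hder : ∀ t : ℝ, HasDerivAt (fun t : ℝ => φ (x + t • ((a, -1) : ℝ × ℝ)))
      (a * d1 φ (x + t • ((a, -1) : ℝ × ℝ)) - d2 φ (x + t • ((a, -1) : ℝ × ℝ))) t := fun t => by
    have hl : HasDerivAt (fun t : ℝ => x + t • ((a, -1) : ℝ × ℝ)) ((a, -1) : ℝ × ℝ) t := by
      simpa using ((hasDerivAt_id t).smul_const ((a, -1) : ℝ × ℝ)).const_add x
    have := (hφ.differentiable (x + t • ((a, -1) : ℝ × ℝ))).hasFDerivAt.comp_hasDerivAt t hl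
    have e : ((a, -1) : ℝ × ℝ) = a • ((1, 0) : ℝ × ℝ) + (-1 : ℝ) • ((0, 1) : ℝ × ℝ) := by
      ext <;> simp
    refine this.congr_deriv ?_
    conv_lhs => arg 2; rw [e]
    rw [map_add, map_smul, map_smul, d1, d2, smul_eq_mul, smul_eq_mul]
    ring
  have hend : φ (x + x.2 • ((a, -1) : ℝ × ℝ)) = 0 := by
    refine image_eq_zero_of_notMem_tsupport fun h => Set.disjoint_left.1 hφ.disjoint_slit h ?_
    exact ⟨by simp, Or.inl (by simpa [mul_comm] using ha)⟩
  have hcont : Continuous fun t : ℝ =>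
      a * d1 φ (x + t • ((a, -1) : ℝ × ℝ)) - d2 φ (x + t • ((a, -1) : ℝ × ℝ)) := by fun_prop
  have hftc := intervalIntegral.integral_eq_sub_of_hasDerivAt (a := 0) (b := x.2)
    (fun t _ => hder t) (hcont.intervalIntegrable _ _)
  rw [hend, zero_smul, add_zero, zero_sub] at hftc
  have hcs := sq_integral_le hcont hx
  rw [hftc, neg_sq] at hcs
  refine hcs.trans (mul_le_mul_of_nonneg_left ?_ hx.le)
  rw [← intervalIntegral.integral_const_mul]
  refine intervalIntegral.integral_mono_on hx.le (Continuous.intervalIntegrable (by fun_prop) _ _)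
    (Continuous.intervalIntegrable (by fun_prop) _ _) fun t _ => ?_
  generalize d1 φ _ = p
  generalize d2 φ _ = q
  nlinarith [sq_nonneg (a * q + p)]

/-- The Poincaré inequality for test functions on a compact subset of the half-plane. The constant
comes from oblique segments that start in `K` and run into the slit. -/
lemma exists_poincare {K : Set (ℝ × ℝ)} (hK : IsCompact K) (hKH : K ⊆ halfPlane) :
    ∃ C : ℝ, ∀ φ : ℝ × ℝ → ℝ, IsTest φ →
      ∫⁻ x in K, ENNReal.ofReal (φ x ^ 2) ≤
        ENNReal.ofReal C * ∫⁻ x in halfPlane, ENNReal.ofReal (d1 φ x ^ 2 + d2 φ x ^ 2) := by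
  rcases K.eq_empty_or_nonempty with rfl | hne
  · exact ⟨0, fun φ _ => by simp⟩
  obtain ⟨y, hyK, hy⟩ := hK.exists_isMinOn hne continuous_snd.continuousOn
  obtain ⟨z, hzK, hz⟩ := hK.exists_isMaxOn hne continuous_snd.continuousOn
  obtain ⟨q, hqK, hq⟩ := hK.exists_isMinOn hne continuous_fst.continuousOn
  have hy0 : 0 < y.2 := hKH hyK
  have hz0 : 0 < z.2 := hKH hzK
  -- With this slope, segments in direction `(a, -1)` from `K` reach height `0` at abscissa `≥ 1`.
  set a : ℝ := (1 + |q.1|) / y.2 with ha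
  have ha0 : 0 ≤ a := by positivity
  refine ⟨z.2 * (1 + a ^ 2) * z.2, fun φ hφ => ?_⟩
  have c1 := continuous_d1 hφ.smooth
  have c2 := continuous_d2 hφ.smooth
  set k : ℝ × ℝ → ENNReal :=
    halfPlane.indicator fun x => ENNReal.ofReal (d1 φ x ^ 2 + d2 φ x ^ 2) with hk
  have hkm : Measurable k :=
    (Measurable.ennreal_ofReal (by fun_prop)).indicator measurableSet_halfPlane
  have hpt : ∀ x ∈ K, ENNReal.ofReal (φ x ^ 2) ≤ ENNReal.ofReal (z.2 * (1 + a ^ 2)) *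
      ∫⁻ t in Set.Ioo 0 z.2, k (x + t • ((a, -1) : ℝ × ℝ)) := fun x hx => by
    have hx0 : 0 < x.2 := hKH hx
    have hyx : y.2 ≤ x.2 := hy hx
    have hxz : x.2 ≤ z.2 := hz hx
    have hqx : q.1 ≤ x.1 := hq hx
    have hax : 1 ≤ x.1 + a * x.2 := by
      have h1 : a * y.2 = 1 + |q.1| := by rw [ha]; field_simp
      have h2 := mul_le_mul_of_nonneg_left hyx ha0
      linarith [neg_abs_le q.1]
    have hint : 0 ≤ ∫ t in 0..x.2,
        (d1 φ (x + t • ((a, -1) : ℝ × ℝ)) ^ 2 + d2 φ (x + t • ((a, -1) : ℝ × ℝ)) ^ 2) :=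
      intervalIntegral.integral_nonneg hx0.le fun t _ => by positivity
    have h3 : φ x ^ 2 ≤ z.2 * (1 + a ^ 2) * ∫ t in 0..x.2,
        (d1 φ (x + t • ((a, -1) : ℝ × ℝ)) ^ 2 + d2 φ (x + t • ((a, -1) : ℝ × ℝ)) ^ 2) := by
      refine (hφ.sq_le hx0 hax).trans ?_
      rw [mul_assoc z.2]
      exact mul_le_mul_of_nonneg_right hxz (by positivity)
    refine (ENNReal.ofReal_le_ofReal h3).trans ?_
    rw [ENNReal.ofReal_mul (by positivity)]
    gcongr
    rw [intervalIntegral.integral_of_le hx0.le, integral_Ioc_eq_integral_Ioo,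
      ofReal_integral_eq_lintegral_ofReal]
    · refine (setLIntegral_mono (by fun_prop) fun t ht => ?_).trans
        (lintegral_mono_set (Set.Ioo_subset_Ioo_right hxz))
      have hmem : x + t • ((a, -1) : ℝ × ℝ) ∈ halfPlane := by
        have := ht.2
        change 0 < (x + t • ((a, -1) : ℝ × ℝ)).2
        simp
        linarith
      rw [hk, Set.indicator_of_mem hmem]
    · refine (Continuous.integrableOn_Icc (a := 0) (b := x.2) ?_).mono_set Set.Ioo_subset_Icc_self
      fun_prop
    · exact ae_of_all _ fun t => by positivity
  calc ∫⁻ x in K, ENNReal.ofReal (φ x ^ 2)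
      ≤ ∫⁻ x in K, ENNReal.ofReal (z.2 * (1 + a ^ 2)) *
          ∫⁻ t in Set.Ioo 0 z.2, k (x + t • ((a, -1) : ℝ × ℝ)) :=
        setLIntegral_mono' hK.measurableSet hpt
    _ ≤ ∫⁻ x, ENNReal.ofReal (z.2 * (1 + a ^ 2)) *
          ∫⁻ t in Set.Ioo 0 z.2, k (x + t • ((a, -1) : ℝ × ℝ)) := setLIntegral_le_lintegral _ _
    _ = ENNReal.ofReal (z.2 * (1 + a ^ 2)) *
          ∫⁻ t in Set.Ioo 0 z.2, ∫⁻ x, k (x + t • ((a, -1) : ℝ × ℝ)) := by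
        rw [lintegral_const_mul' _ _ ENNReal.ofReal_ne_top, lintegral_lintegral_swap]
        refine Measurable.aemeasurable ?_
        exact hkm.comp (by fun_prop)
    _ = ENNReal.ofReal (z.2 * (1 + a ^ 2) * z.2) *
          ∫⁻ x in halfPlane, ENNReal.ofReal (d1 φ x ^ 2 + d2 φ x ^ 2) := by
        simp only [lintegral_add_right_eq_self]
        rw [lintegral_const, Measure.restrict_apply_univ, Real.volume_Ioo, sub_zero, hk,
          lintegral_indicator measurableSet_halfPlane,
          ENNReal.ofReal_mul (p := z.2 * (1 + a ^ 2)) (by positivity)]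
        ring

/-! ### Uniqueness -/

/-- Pythagoras in `L²`: if `G` is orthogonal to `h`, then `h` is no longer than `h - G`. -/
lemma lintegral_sq_le_of_orthogonal {G₁ G₂ h₁ h₂ : ℝ × ℝ → ℝ} {μ : Measure (ℝ × ℝ)}
    (hG₁ : MemLp G₁ 2 μ) (hG₂ : MemLp G₂ 2 μ) (hh₁ : MemLp h₁ 2 μ) (hh₂ : MemLp h₂ 2 μ)
    (horth : ∫ x, (G₁ x * h₁ x + G₂ x * h₂ x) ∂μ = 0) :
    ∫⁻ x, ENNReal.ofReal (h₁ x ^ 2 + h₂ x ^ 2) ∂μ ≤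
      ∫⁻ x, ENNReal.ofReal ((h₁ x - G₁ x) ^ 2 + (h₂ x - G₂ x) ^ 2) ∂μ := by
  have ih : Integrable (fun x => h₁ x ^ 2 + h₂ x ^ 2) μ := hh₁.integrable_sq.add hh₂.integrable_sq
  have iG : Integrable (fun x => G₁ x ^ 2 + G₂ x ^ 2) μ := hG₁.integrable_sq.add hG₂.integrable_sq
  have ic : Integrable (fun x => G₁ x * h₁ x + G₂ x * h₂ x) μ :=
    (hG₁.integrable_mul hh₁).add (hG₂.integrable_mul hh₂)
  have id : Integrable (fun x => (h₁ x - G₁ x) ^ 2 + (h₂ x - G₂ x) ^ 2) μ :=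
    (hh₁.sub hG₁).integrable_sq.add (hh₂.sub hG₂).integrable_sq
  rw [← ofReal_integral_eq_lintegral_ofReal ih (ae_of_all _ fun x => by positivity),
    ← ofReal_integral_eq_lintegral_ofReal id (ae_of_all _ fun x => by positivity)]
  refine ENNReal.ofReal_le_ofReal ?_
  have e : ∀ x, (h₁ x - G₁ x) ^ 2 + (h₂ x - G₂ x) ^ 2 =
      h₁ x ^ 2 + h₂ x ^ 2 + (G₁ x ^ 2 + G₂ x ^ 2) - 2 * (G₁ x * h₁ x + G₂ x * h₂ x) :=
    fun x => by ring
  have h := integral_sub (ih.add iG) (ic.const_mul 2)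
  simp only [Pi.add_apply] at h
  simp only [e]
  rw [h, integral_add ih iG, integral_const_mul, horth]
  have : 0 ≤ ∫ x, (G₁ x ^ 2 + G₂ x ^ 2) ∂μ := integral_nonneg fun x => by positivity
  linarith

lemma tendsto_eLpNorm_sub_sub {f g : ℕ → ℝ × ℝ → ℝ} {u v : ℝ × ℝ → ℝ} {μ : Measure (ℝ × ℝ)}
    (hf : ∀ n, AEStronglyMeasurable (f n) μ) (hg : ∀ n, AEStronglyMeasurable (g n) μ)
    (hu : AEStronglyMeasurable u μ) (hv : AEStronglyMeasurable v μ)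
    (hfu : Tendsto (fun n => eLpNorm (fun x => f n x - u x) 2 μ) atTop (𝓝 0))
    (hgv : Tendsto (fun n => eLpNorm (fun x => g n x - v x) 2 μ) atTop (𝓝 0)) :
    Tendsto (fun n => eLpNorm (fun x => (f n x - g n x) - (u x - v x)) 2 μ) atTop (𝓝 0) := by
  have h := hfu.add hgv
  rw [add_zero] at h
  refine tendsto_of_tendsto_of_tendsto_of_le_of_le tendsto_const_nhds h (fun _ => zero_le)
    fun n => ?_
  refine le_trans (le_of_eq ?_) (eLpNorm_sub_le ((hf n).sub hu) ((hg n).sub hv) one_le_two)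
  congr 1
  ext x
  simp only [Pi.sub_apply]
  ring

/-- Weak solutions are unique: the difference of two of them is a limit of test functions whose
gradients tend to zero, hence vanishes by the Poincaré inequality. -/
theorem IsWeakSolution.ae_eq {k : ℕ} {v w : ℝ × ℝ → ℝ} (hv : IsWeakSolution k v)
    (hw : IsWeakSolution k w) : v =ᵐ[volume.restrict halfPlane] w := by
  obtain ⟨g₁, g₂, ⟨hg, φ, hφ, hφ1, hφ2, hφK⟩, hgφ⟩ := hv
  obtain ⟨e₁, e₂, ⟨he, θ, hθ, hθ1, hθ2, hθK⟩, heφ⟩ := hw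
  set μ := (volume : Measure (ℝ × ℝ)).restrict halfPlane with hμ
  have hψ : ∀ n, IsTest (fun x => φ n x - θ n x) := fun n => (hφ n).sub (hθ n)
  have hd1 : ∀ n, d1 (fun x => φ n x - θ n x) = fun x => d1 (φ n) x - d1 (θ n) x := fun n =>
    funext fun x => d1_sub ((hφ n).differentiable x) ((hθ n).differentiable x)
  have hd2 : ∀ n, d2 (fun x => φ n x - θ n x) = fun x => d2 (φ n) x - d2 (θ n) x := fun n =>
    funext fun x => d2_sub ((hφ n).differentiable x) ((hθ n).differentiable x)
  have hG1 : MemLp (fun x => g₁ x - e₁ x) 2 μ := hg.memLp_fst.sub he.memLp_fst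
  have hG2 : MemLp (fun x => g₂ x - e₂ x) 2 μ := hg.memLp_snd.sub he.memLp_snd
  have t1 := tendsto_eLpNorm_sub_sub (fun n => (hφ n).memLp_d1.1) (fun n => (hθ n).memLp_d1.1)
    hg.memLp_fst.1 he.memLp_fst.1 hφ1 hθ1
  have t2 := tendsto_eLpNorm_sub_sub (fun n => (hφ n).memLp_d2.1) (fun n => (hθ n).memLp_d2.1)
    hg.memLp_snd.1 he.memLp_snd.1 hφ2 hθ2
  have horth : ∀ ψ, IsTest ψ →
      ∫ x, ((g₁ x - e₁ x) * d1 ψ x + (g₂ x - e₂ x) * d2 ψ x) ∂μ = 0 := fun ψ hψ => by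
    have e : ∀ x, (g₁ x - e₁ x) * d1 ψ x + (g₂ x - e₂ x) * d2 ψ x =
        (g₁ x * d1 ψ x + g₂ x * d2 ψ x) - (e₁ x * d1 ψ x + e₂ x * d2 ψ x) := fun x => by ring
    simp only [e]
    rw [integral_sub, hgφ ψ hψ, heφ ψ hψ, sub_self]
    · exact (hg.memLp_fst.integrable_mul hψ.memLp_d1).add (hg.memLp_snd.integrable_mul hψ.memLp_d2)
    · exact (he.memLp_fst.integrable_mul hψ.memLp_d1).add (he.memLp_snd.integrable_mul hψ.memLp_d2)
  -- The gradients of the approximations of `v - w` tend to zero.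
  have hgrad : Tendsto (fun n => ∫⁻ x in halfPlane,
      ENNReal.ofReal (d1 (fun x => φ n x - θ n x) x ^ 2 + d2 (fun x => φ n x - θ n x) x ^ 2))
      atTop (𝓝 0) := by
    have hsum := (tendsto_sq_zero t1).add (tendsto_sq_zero t2)
    rw [add_zero] at hsum
    refine tendsto_of_tendsto_of_tendsto_of_le_of_le tendsto_const_nhds hsum (fun _ => zero_le)
      fun n => ?_
    refine (lintegral_sq_le_of_orthogonal hG1 hG2 (hψ n).memLp_d1 (hψ n).memLp_d2
      (horth _ (hψ n))).trans (le_of_eq ?_)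
    simp only [hd1, hd2]
    refine lintegral_ofReal_sq_add_sq (AEStronglyMeasurable.sub ?_ hG1.1)
    exact ((hφ n).memLp_d1.sub (hθ n).memLp_d1).1
  have hcompact : ∀ K, IsCompact K → K ⊆ halfPlane → v =ᵐ[volume.restrict K] w := by
    intro K hK hKH
    obtain ⟨C, hC⟩ := exists_poincare hK hKH
    have hvm : AEStronglyMeasurable v (volume.restrict K) :=
      (hg.locallyIntegrable.integrableOn_compact_subset hKH hK).1
    have hwm : AEStronglyMeasurable w (volume.restrict K) :=
      (he.locallyIntegrable.integrableOn_compact_subset hKH hK).1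
    have hφm : ∀ n, AEStronglyMeasurable (φ n) (volume.restrict K) := fun n =>
      (hφ n).smooth.continuous.aestronglyMeasurable
    have hθm : ∀ n, AEStronglyMeasurable (θ n) (volume.restrict K) := fun n =>
      (hθ n).smooth.continuous.aestronglyMeasurable
    have s1 := tendsto_eLpNorm_sub_sub hφm hθm hvm hwm (hφK K hK hKH) (hθK K hK hKH)
    have s2 : Tendsto (fun n => eLpNorm (fun x => φ n x - θ n x) 2 (volume.restrict K))
        atTop (𝓝 0) := by
      have hl := ENNReal.Tendsto.const_mul hgrad (Or.inr (ENNReal.ofReal_ne_top (r := C)))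
      rw [mul_zero] at hl
      refine tendsto_zero_of_sq (tendsto_of_tendsto_of_tendsto_of_le_of_le tendsto_const_nhds hl
        (fun _ => zero_le) fun n => ?_)
      simp only [eLpNorm_two_sq]
      exact hC _ (hψ n)
    have s3 := s2.add s1
    rw [add_zero] at s3
    have hle : ∀ n, eLpNorm (fun x => v x - w x) 2 (volume.restrict K) ≤
        eLpNorm (fun x => φ n x - θ n x) 2 (volume.restrict K) +
        eLpNorm (fun x => (φ n x - θ n x) - (v x - w x)) 2 (volume.restrict K) := fun n => by
      refine le_trans (le_of_eq ?_) (eLpNorm_sub_le ((hφm n).sub (hθm n))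
        (((hφm n).sub (hθm n)).sub (hvm.sub hwm)) one_le_two)
      congr 1
      ext x
      simp
    have h0 : eLpNorm (fun x => v x - w x) 2 (volume.restrict K) = 0 :=
      le_antisymm (ge_of_tendsto' s3 hle) zero_le
    filter_upwards [(eLpNorm_eq_zero_iff (hvm.sub hwm) two_ne_zero).1 h0] with x hx
    exact sub_eq_zero.1 hx
  rw [EventuallyEq, ae_restrict_iff' measurableSet_halfPlane, ae_iff]
  refine measure_null_of_locally_null _ fun x hx => ?_
  have hxH : x ∈ halfPlane := by
    by_contra h
    exact hx fun h' => absurd h' h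
  obtain ⟨K, hKn, hKH, hK⟩ := local_compact_nhds (isOpen_halfPlane.mem_nhds hxH)
  refine ⟨_, inter_mem_nhdsWithin _ hKn, ?_⟩
  have h := hcompact K hK hKH
  rw [EventuallyEq, ae_restrict_iff' hK.measurableSet, ae_iff] at h
  refine measure_mono_null (fun y hy => ?_) h
  exact fun h' => hy.1 fun _ => h' hy.2

/-! ### Sums of decaying modes -/

/-- A finite sum of the harmonic modes `e^{-mξ} sin(mη)`. -/
def sinSum (s : Finset ℕ) (m : ℕ → ℕ) (c : ℕ → ℝ) (p : ℝ × ℝ) : ℝ :=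
  ∑ j ∈ s, c j * (Real.exp (-m j * p.1) * Real.sin (m j * p.2))

/-- A finite sum of the harmonic modes `e^{-mξ} cos(mη)`. -/
def cosSum (s : Finset ℕ) (m : ℕ → ℕ) (c : ℕ → ℝ) (p : ℝ × ℝ) : ℝ :=
  ∑ j ∈ s, c j * (Real.exp (-m j * p.1) * Real.cos (m j * p.2))

lemma hasFDerivAt_sinSum (s : Finset ℕ) (m : ℕ → ℕ) (c : ℕ → ℝ) (p : ℝ × ℝ) :
    HasFDerivAt (sinSum s m c) (-sinSum s m (fun j => m j * c j) p • ContinuousLinearMap.fst ℝ ℝ ℝ +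
      cosSum s m (fun j => m j * c j) p • ContinuousLinearMap.snd ℝ ℝ ℝ) p := by
  have h : ∀ j ∈ s, HasFDerivAt
      (fun p : ℝ × ℝ => c j * (Real.exp (-m j * p.1) * Real.sin (m j * p.2))) _ p := fun j _ =>
    (HasFDerivAt.mul ((hasFDerivAt_fst.const_mul (-m j : ℝ)).exp)
      ((hasFDerivAt_snd.const_mul (m j : ℝ)).sin)).const_mul (c j)
  refine (HasFDerivAt.fun_sum h).congr_fderiv (ContinuousLinearMap.ext fun v => ?_)
  simp only [sinSum, cosSum, _root_.sum_apply, _root_.add_apply, _root_.smul_apply,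
    ContinuousLinearMap.coe_fst', ContinuousLinearMap.coe_snd', smul_eq_mul,
    ← Finset.sum_neg_distrib, Finset.sum_mul, ← Finset.sum_add_distrib]
  refine Finset.sum_congr rfl fun j _ => ?_
  ring

lemma hasFDerivAt_cosSum (s : Finset ℕ) (m : ℕ → ℕ) (c : ℕ → ℝ) (p : ℝ × ℝ) :
    HasFDerivAt (cosSum s m c) (-cosSum s m (fun j => m j * c j) p • ContinuousLinearMap.fst ℝ ℝ ℝ -
      sinSum s m (fun j => m j * c j) p • ContinuousLinearMap.snd ℝ ℝ ℝ) p := by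
  have h : ∀ j ∈ s, HasFDerivAt
      (fun p : ℝ × ℝ => c j * (Real.exp (-m j * p.1) * Real.cos (m j * p.2))) _ p := fun j _ =>
    (HasFDerivAt.mul ((hasFDerivAt_fst.const_mul (-m j : ℝ)).exp)
      ((hasFDerivAt_snd.const_mul (m j : ℝ)).cos)).const_mul (c j)
  refine (HasFDerivAt.fun_sum h).congr_fderiv (ContinuousLinearMap.ext fun v => ?_)
  simp only [sinSum, cosSum, _root_.sum_apply, _root_.add_apply, _root_.smul_apply,
    _root_.sub_apply, ContinuousLinearMap.coe_fst', ContinuousLinearMap.coe_snd', smul_eq_mul,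
    ← Finset.sum_neg_distrib, Finset.sum_mul, ← Finset.sum_sub_distrib]
  refine Finset.sum_congr rfl fun j _ => ?_
  ring

lemma contDiff_sinSum (s : Finset ℕ) (m : ℕ → ℕ) (c : ℕ → ℝ) : ContDiff ℝ ∞ (sinSum s m c) := by
  unfold sinSum
  fun_prop

lemma contDiff_cosSum (s : Finset ℕ) (m : ℕ → ℕ) (c : ℕ → ℝ) : ContDiff ℝ ∞ (cosSum s m c) := by
  unfold cosSum
  fun_prop

lemma d1_sinSum (s : Finset ℕ) (m : ℕ → ℕ) (c : ℕ → ℝ) (p : ℝ × ℝ) :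
    d1 (sinSum s m c) p = -sinSum s m (fun j => m j * c j) p := by
  simp [d1, (hasFDerivAt_sinSum s m c p).fderiv]

lemma d2_sinSum (s : Finset ℕ) (m : ℕ → ℕ) (c : ℕ → ℝ) (p : ℝ × ℝ) :
    d2 (sinSum s m c) p = cosSum s m (fun j => m j * c j) p := by
  simp [d2, (hasFDerivAt_sinSum s m c p).fderiv]

lemma abs_sin_natCast_mul_le (n : ℕ) (x : ℝ) : |Real.sin (n * x)| ≤ n * |Real.sin x| := by
  induction n with
  | zero => simp
  | succ n ih =>
    have e : ((n + 1 : ℕ) : ℝ) * x = n * x + x := by push_cast; ring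
    rw [e, Real.sin_add]
    refine (abs_add_le _ _).trans ?_
    rw [abs_mul, abs_mul]
    push_cast
    have h1 := Real.abs_cos_le_one x
    have h2 := Real.abs_cos_le_one (n * x)
    have h3 := abs_nonneg (Real.sin x)
    have h4 := abs_nonneg (Real.sin (n * x))
    nlinarith

lemma exp_neg_natCast_mul_le {n : ℕ} (hn : 1 ≤ n) {x : ℝ} (hx : 0 ≤ x) :
    Real.exp (-n * x) ≤ Real.exp (-x) := by
  have : (1 : ℝ) ≤ n := by exact_mod_cast hn
  exact Real.exp_le_exp.2 (by nlinarith)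

lemma abs_sinSum_le_mul_sin {s : Finset ℕ} {m : ℕ → ℕ} (hm : ∀ j ∈ s, 1 ≤ m j) (c : ℕ → ℝ)
    {p : ℝ × ℝ} (hp : 0 ≤ p.1) :
    |sinSum s m c p| ≤ (∑ j ∈ s, |m j * c j|) * (Real.exp (-p.1) * |Real.sin p.2|) := by
  rw [sinSum, Finset.sum_mul]
  refine (Finset.abs_sum_le_sum_abs _ _).trans (Finset.sum_le_sum fun j hj => ?_)
  rw [abs_mul, abs_mul, Real.abs_exp, abs_mul (m j : ℝ), Nat.abs_cast]
  calc |c j| * (Real.exp (-m j * p.1) * |Real.sin (m j * p.2)|)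
      ≤ |c j| * (Real.exp (-p.1) * (m j * |Real.sin p.2|)) := by
        refine mul_le_mul_of_nonneg_left (mul_le_mul (exp_neg_natCast_mul_le (hm j hj) hp)
          (abs_sin_natCast_mul_le _ _) (abs_nonneg _) (Real.exp_pos _).le) (abs_nonneg _)
    _ = _ := by ring

lemma abs_sinSum_le {s : Finset ℕ} {m : ℕ → ℕ} (hm : ∀ j ∈ s, 1 ≤ m j) (c : ℕ → ℝ)
    {p : ℝ × ℝ} (hp : 0 ≤ p.1) :
    |sinSum s m c p| ≤ (∑ j ∈ s, |c j|) * Real.exp (-p.1) := by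
  rw [sinSum, Finset.sum_mul]
  refine (Finset.abs_sum_le_sum_abs _ _).trans (Finset.sum_le_sum fun j hj => ?_)
  rw [abs_mul, abs_mul, Real.abs_exp]
  have h := mul_le_mul (exp_neg_natCast_mul_le (hm j hj) hp) (Real.abs_sin_le_one (m j * p.2))
    (abs_nonneg _) (Real.exp_pos _).le
  rw [mul_one] at h
  exact mul_le_mul_of_nonneg_left h (abs_nonneg _)

lemma abs_cosSum_le {s : Finset ℕ} {m : ℕ → ℕ} (hm : ∀ j ∈ s, 1 ≤ m j) (c : ℕ → ℝ)
    {p : ℝ × ℝ} (hp : 0 ≤ p.1) :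
    |cosSum s m c p| ≤ (∑ j ∈ s, |c j|) * Real.exp (-p.1) := by
  rw [cosSum, Finset.sum_mul]
  refine (Finset.abs_sum_le_sum_abs _ _).trans (Finset.sum_le_sum fun j hj => ?_)
  rw [abs_mul, abs_mul, Real.abs_exp]
  have h := mul_le_mul (exp_neg_natCast_mul_le (hm j hj) hp) (Real.abs_cos_le_one (m j * p.2))
    (abs_nonneg _) (Real.exp_pos _).le
  rw [mul_one] at h
  exact mul_le_mul_of_nonneg_left h (abs_nonneg _)

lemma lintegral_exp_lt_top (B : ℝ) :
    ∫⁻ p in D, ENNReal.ofReal (B * Real.exp (-2 * p.1)) < ⊤ := by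
  have h1 : Integrable (fun ξ : ℝ => B * Real.exp (-2 * ξ)) (volume.restrict (Set.Ioi 0)) :=
    (integrableOn_exp_mul_Ioi (by norm_num) 0).const_mul B
  have h2 : Integrable (fun _ : ℝ => (1 : ℝ)) (volume.restrict (Set.Ioo 0 Real.pi)) :=
    integrable_const 1
  have h := h1.mul_prod h2
  rw [Measure.prod_restrict, ← Measure.volume_eq_prod] at h
  simp only [mul_one] at h
  exact h.lintegral_lt_top

/-! ### Approximation by test functions -/

/-- A cut-off in elliptic coordinates: it is supported in `-2 ≤ ξ ≤ n`, `1 ≤ n sin η`, and equal to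
`1` where `-1 ≤ ξ ≤ n - 1`, `2 ≤ n sin η`. The range `-2 ≤ ξ < 0` lies across `Γ₁`; a test
function is a smooth function on both sides of that segment. -/
def cutoff (n : ℕ) (p : ℝ × ℝ) : ℝ :=
  Real.smoothTransition (p.1 + 2) *
    (Real.smoothTransition (n - p.1) * Real.smoothTransition (n * Real.sin p.2 - 1))

lemma contDiff_cutoff (n : ℕ) : ContDiff ℝ ∞ (cutoff n) := by
  have h : ContDiff ℝ ∞ Real.smoothTransition := Real.smoothTransition.contDiff
  exact (h.comp (by fun_prop)).mul ((h.comp (by fun_prop)).mul (h.comp (by fun_prop)))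

lemma isTest_cutoff {U : ℝ × ℝ → ℝ} (hU : ContDiff ℝ ∞ U) (n : ℕ) :
    IsTest (fun x => cutoff n (ellipticInv x) * U (ellipticInv x)) := by
  refine isTest_comp_ellipticInv (Φ := fun p => cutoff n p * U p) ((contDiff_cutoff n).mul hU)
    (K := (Set.Icc (-2) (n : ℝ) ×ˢ Set.Icc 0 Real.pi) ∩ {p | 1 ≤ n * Real.sin p.2}) ?_ ?_ ?_ ?_
  · exact (isCompact_Icc.prod isCompact_Icc).inter_right
      (isClosed_le continuous_const (by fun_prop))
  · rintro p ⟨⟨-, h0, hpi⟩, h1⟩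
    have h1 : 1 ≤ n * Real.sin p.2 := h1
    refine ⟨lt_of_le_of_ne h0 fun h => ?_, lt_of_le_of_ne hpi fun h => ?_⟩
    · rw [← h] at h1
      norm_num at h1
    · rw [h] at h1
      norm_num at h1
  · intro p hp hpK
    by_contra hne
    have hc := left_ne_zero_of_mul hne
    have h1 : ¬ p.1 + 2 ≤ 0 := fun h =>
      left_ne_zero_of_mul hc (Real.smoothTransition.zero_of_nonpos h)
    have hc' := right_ne_zero_of_mul hc
    have h2 : ¬ n - p.1 ≤ 0 := fun h =>
      left_ne_zero_of_mul hc' (Real.smoothTransition.zero_of_nonpos h)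
    have h3 : ¬ n * Real.sin p.2 - 1 ≤ 0 := fun h =>
      right_ne_zero_of_mul hc' (Real.smoothTransition.zero_of_nonpos h)
    push Not at h1 h2 h3
    refine hpK ⟨⟨⟨by linarith, by linarith⟩, hp.1.le, hp.2.le⟩, ?_⟩
    change 1 ≤ n * Real.sin p.2
    linarith
  · intro p hp
    simp [cutoff, hp, Real.smoothTransition.zero_of_nonpos]

lemma deriv_smoothTransition_eq_zero {x : ℝ} (h : 1 < x) : deriv Real.smoothTransition x = 0 := by
  have : Real.smoothTransition =ᶠ[𝓝 x] fun _ => 1 := by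
    filter_upwards [Ioi_mem_nhds h] with y hy
    exact Real.smoothTransition.one_of_one_le (le_of_lt hy)
  rw [this.deriv_eq, deriv_const]

lemma exists_deriv_smoothTransition_bound :
    ∃ M : ℝ, ∀ x, |deriv Real.smoothTransition x| ≤ M := by
  have hc : Continuous (deriv Real.smoothTransition) :=
    (Real.smoothTransition.contDiff (n := 1)).continuous_deriv le_rfl
  have hs : HasCompactSupport (deriv Real.smoothTransition) := by
    refine HasCompactSupport.intro (K := Set.Icc 0 1) isCompact_Icc fun x hx => ?_
    rcases lt_or_ge x 0 with h | h
    · have : Real.smoothTransition =ᶠ[𝓝 x] fun _ => 0 := by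
        filter_upwards [Iio_mem_nhds h] with y hy
        exact Real.smoothTransition.zero_of_nonpos (le_of_lt hy)
      rw [this.deriv_eq, deriv_const]
    · have h1 : 1 < x := by
        by_contra! h'
        exact hx ⟨h, h'⟩
      exact deriv_smoothTransition_eq_zero h1
  obtain ⟨M, hM⟩ := hc.bounded_above_of_compact_support hs
  exact ⟨M, fun x => hM x⟩

/-- The error `(χ - 1) U` of the cut-off and its derivatives on `D`. The factor of the cut-off that
acts in `ξ < 0` is `1` there. -/
lemma d1_d2_cutoff_error {U : ℝ × ℝ → ℝ} {p : ℝ × ℝ} (hU : DifferentiableAt ℝ U p) (hp : p ∈ D)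
    (n : ℕ) :
    d1 (fun q => cutoff n q * U q - U q) p =
      -(deriv Real.smoothTransition (n - p.1) * Real.smoothTransition (n * Real.sin p.2 - 1)) * U p
        + (Real.smoothTransition (n - p.1) * Real.smoothTransition (n * Real.sin p.2 - 1) - 1) *
          d1 U p ∧
    d2 (fun q => cutoff n q * U q - U q) p =
      Real.smoothTransition (n - p.1) * (deriv Real.smoothTransition (n * Real.sin p.2 - 1) *
        (n * Real.cos p.2)) * U p
        + (Real.smoothTransition (n - p.1) * Real.smoothTransition (n * Real.sin p.2 - 1) - 1) *
          d2 U p := by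
  have heq : Set.EqOn (fun q => cutoff n q * U q - U q) (fun q =>
      (Real.smoothTransition (n - q.1) * Real.smoothTransition (n * Real.sin q.2 - 1) - 1) * U q)
      D := fun q hq => by
    have : 0 < q.1 := hq.1
    simp only [cutoff]
    rw [Real.smoothTransition.one_of_one_le (x := q.1 + 2) (by linarith)]
    ring
  have hT : ∀ x : ℝ, HasDerivAt Real.smoothTransition (deriv Real.smoothTransition x) x := fun x =>
    ((Real.smoothTransition.contDiff (n := 1)).differentiable one_ne_zero x).hasDerivAt
  have hA : HasFDerivAt (fun q : ℝ × ℝ => Real.smoothTransition (n - q.1)) _ p :=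
    (hT (n - p.1)).comp_hasFDerivAt (f := fun q : ℝ × ℝ => (n : ℝ) - q.1) p
      ((hasFDerivAt_fst (𝕜 := ℝ) (p := p)).const_sub (n : ℝ))
  have hB : HasFDerivAt (fun q : ℝ × ℝ => Real.smoothTransition (n * Real.sin q.2 - 1)) _ p :=
    (hT (n * Real.sin p.2 - 1)).comp_hasFDerivAt (f := fun q : ℝ × ℝ => n * Real.sin q.2 - 1) p
      ((hasFDerivAt_snd.sin.const_mul (n : ℝ)).sub_const 1)
  have hE := (((hA.mul hB).sub_const 1).mul hU.hasFDerivAt).fderiv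
  rw [d1_congr isOpen_D heq hp, d2_congr isOpen_D heq hp]
  constructor
  · simp only [d1]
    refine (congrArg (fun L : ℝ × ℝ →L[ℝ] ℝ => L (1, 0)) hE).trans ?_
    simp
    ring
  · simp only [d2]
    refine (congrArg (fun L : ℝ × ℝ →L[ℝ] ℝ => L (0, 1)) hE).trans ?_
    simp
    ring

/-- The cut-off costs no energy in the limit. Near the boundary of the strip its derivative is of
order `n` where `sin η` is of order `1 / n`, which the vanishing of `U` compensates; dominated
convergence applies. -/
lemma tendsto_energy_cutoff_error {U : ℝ × ℝ → ℝ} (hU : ContDiff ℝ ∞ U) {C : ℝ}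
    (h0 : ∀ p ∈ D, |U p| ≤ C * (Real.exp (-p.1) * Real.sin p.2))
    (h1 : ∀ p ∈ D, |d1 U p| ≤ C * Real.exp (-p.1))
    (h2 : ∀ p ∈ D, |d2 U p| ≤ C * Real.exp (-p.1)) :
    Tendsto (fun n : ℕ => ∫⁻ p in D, ENNReal.ofReal
      (d1 (fun q => cutoff n q * U q - U q) p ^ 2 + d2 (fun q => cutoff n q * U q - U q) p ^ 2))
      atTop (𝓝 0) := by
  obtain ⟨M, hM⟩ := exists_deriv_smoothTransition_bound
  have hM0 : 0 ≤ M := (abs_nonneg _).trans (hM 0)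
  have hdiff : Differentiable ℝ U := hU.differentiable (by simp)
  have hpi := Real.pi_pos
  have hC : 0 ≤ C := by
    have := (abs_nonneg _).trans
      (h1 (1, Real.pi / 2) ⟨one_pos (α := ℝ), half_pos hpi, half_lt_self hpi⟩)
    exact nonneg_of_mul_nonneg_left this (Real.exp_pos _)
  set B := ((2 * M + 1) * C) ^ 2 + ((2 * M + 1) * C) ^ 2 with hB
  have hsmooth : ∀ n, ContDiff ℝ ∞ (fun q => cutoff n q * U q - U q) := fun n =>
    ((contDiff_cutoff n).mul hU).sub hU
  have hlim := tendsto_lintegral_of_dominated_convergence (μ := volume.restrict D)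
    (F := fun (n : ℕ) p => ENNReal.ofReal
      (d1 (fun q => cutoff n q * U q - U q) p ^ 2 + d2 (fun q => cutoff n q * U q - U q) p ^ 2))
    (f := fun _ => 0) (fun p => ENNReal.ofReal (B * Real.exp (-2 * p.1)))
    (fun n => by
      have c1 := continuous_d1 (hsmooth n)
      have c2 := continuous_d2 (hsmooth n)
      exact Measurable.ennreal_ofReal (by fun_prop))
    (fun n => by
      filter_upwards [ae_restrict_mem measurableSet_D] with p hp
      refine ENNReal.ofReal_le_ofReal ?_
      obtain ⟨e1, e2⟩ := d1_d2_cutoff_error (hdiff p) hp n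
      have hsin := sin_pos_of_mem_strip (D_subset_strip hp)
      have b0 := h0 p hp
      have b1 := h1 p hp
      have b2 := h2 p hp
      have hexp := Real.exp_pos (-p.1)
      have hT1 := Real.smoothTransition.nonneg (n - p.1)
      have hT2 := Real.smoothTransition.le_one (n - p.1)
      have hS1 := Real.smoothTransition.nonneg (n * Real.sin p.2 - 1)
      have hS2 := Real.smoothTransition.le_one (n * Real.sin p.2 - 1)
      have hM1 := hM (n - p.1)
      -- The derivative lives where `n sin η ≤ 2`.
      have hdecay : |deriv Real.smoothTransition (n * Real.sin p.2 - 1)| * (n * Real.sin p.2) ≤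
          2 * M := by
        rcases lt_or_ge 1 (n * Real.sin p.2 - 1) with h | h
        · rw [deriv_smoothTransition_eq_zero h]
          simpa using hM0
        · rw [mul_comm 2 M]
          exact mul_le_mul (hM _) (by linarith) (by positivity) hM0
      have hcos := Real.abs_cos_le_one p.2
      have hfac : |Real.smoothTransition (n - p.1) * Real.smoothTransition (n * Real.sin p.2 - 1)
          - 1| ≤ 1 := by
        rw [abs_le]
        constructor <;> nlinarith
      have hsin1 := Real.sin_le_one p.2
      have hU1 : |U p| ≤ C * Real.exp (-p.1) := b0.trans (by
        refine mul_le_mul_of_nonneg_left ?_ hC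
        nlinarith)
      have k1 : |d1 (fun q => cutoff n q * U q - U q) p| ≤ (2 * M + 1) * C * Real.exp (-p.1) := by
        rw [e1]
        refine (abs_add_le _ _).trans ?_
        rw [abs_mul, abs_mul, abs_neg, abs_mul, abs_of_nonneg hS1]
        have i1 : |deriv Real.smoothTransition (n - p.1)| *
            Real.smoothTransition (n * Real.sin p.2 - 1) * |U p| ≤
            M * 1 * (C * Real.exp (-p.1)) := by gcongr
        have i2 : |Real.smoothTransition (n - p.1) * Real.smoothTransition (n * Real.sin p.2 - 1)
          - 1| * |d1 U p| ≤ 1 * (C * Real.exp (-p.1)) := by gcongr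
        have i3 : 0 ≤ M * (C * Real.exp (-p.1)) := by positivity
        linarith
      have k2 : |d2 (fun q => cutoff n q * U q - U q) p| ≤ (2 * M + 1) * C * Real.exp (-p.1) := by
        rw [e2]
        refine (abs_add_le _ _).trans ?_
        rw [abs_mul, abs_mul, abs_mul, abs_mul, abs_mul, Nat.abs_cast, abs_of_nonneg hT1]
        have i1 : Real.smoothTransition (n - p.1) *
            (|deriv Real.smoothTransition (n * Real.sin p.2 - 1)| * (n * |Real.cos p.2|)) * |U p| ≤
            1 * (|deriv Real.smoothTransition (n * Real.sin p.2 - 1)| * (n * 1)) *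
              (C * (Real.exp (-p.1) * Real.sin p.2)) := by gcongr
        have i2 : |Real.smoothTransition (n - p.1) * Real.smoothTransition (n * Real.sin p.2 - 1)
          - 1| * |d2 U p| ≤ 1 * (C * Real.exp (-p.1)) := by gcongr
        have i3 := mul_le_mul_of_nonneg_right hdecay (mul_nonneg hC hexp.le)
        linarith
      have hsq : Real.exp (-2 * p.1) = Real.exp (-p.1) ^ 2 := by
        rw [← Real.exp_nat_mul]; ring_nf
      rw [hsq, hB, add_mul, ← mul_pow]
      exact add_le_add (sq_le_sq' (abs_le.1 k1).1 (abs_le.1 k1).2)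
        (sq_le_sq' (abs_le.1 k2).1 (abs_le.1 k2).2))
    (lintegral_exp_lt_top B).ne
    (by
      filter_upwards [ae_restrict_mem measurableSet_D] with p hp
      have hsin := sin_pos_of_mem_strip (D_subset_strip hp)
      obtain ⟨N, hN⟩ := exists_nat_gt (max (p.1 + 1) (2 / Real.sin p.2))
      refine tendsto_const_nhds.congr' ?_
      filter_upwards [eventually_ge_atTop N] with n hn
      have hnN : (N : ℝ) ≤ n := by exact_mod_cast hn
      have a1 : 1 < n - p.1 := by linarith [le_max_left (p.1 + 1) (2 / Real.sin p.2)]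
      have a2 : 1 < n * Real.sin p.2 - 1 := by
        have h := le_max_right (p.1 + 1) (2 / Real.sin p.2)
        have : 2 / Real.sin p.2 < n := by linarith
        rw [div_lt_iff₀ hsin] at this
        linarith
      obtain ⟨e1, e2⟩ := d1_d2_cutoff_error (hdiff p) hp n
      rw [e1, e2, deriv_smoothTransition_eq_zero a1, deriv_smoothTransition_eq_zero a2,
        Real.smoothTransition.one_of_one_le a1.le, Real.smoothTransition.one_of_one_le a2.le]
      simp)
  simpa using hlim

/-- A function that is smooth on the half-plane and has a square-integrable gradient there has its
classical gradient as its weak one. -/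
lemma hasWeakGradient_of_contDiffAt {u : ℝ × ℝ → ℝ} (hu : ∀ x ∈ halfPlane, ContDiffAt ℝ ∞ u x)
    (h1 : MemLp (d1 u) 2 (volume.restrict halfPlane))
    (h2 : MemLp (d2 u) 2 (volume.restrict halfPlane)) : HasWeakGradient u (d1 u) (d2 u) := by
  have hcont : ContinuousOn u halfPlane := fun x hx => (hu x hx).continuousAt.continuousWithinAt
  have hfd : ContinuousOn (fderiv ℝ u) halfPlane := fun x hx =>
    ((hu x hx).fderiv_right (m := 0) (by simp)).continuousAt.continuousWithinAt
  have key : ∀ (v : ℝ × ℝ) (θ : ℝ × ℝ → ℝ), ContDiff ℝ ∞ θ → HasCompactSupport θ →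
      tsupport θ ⊆ halfPlane →
      ∫ x in halfPlane, u x * fderiv ℝ θ x v = -∫ x in halfPlane, fderiv ℝ u x v * θ x := by
    intro v θ hθ hc hs
    have hint : ∀ f g : ℝ × ℝ → ℝ, ContinuousOn f halfPlane → Continuous g →
        tsupport g ⊆ tsupport θ → Integrable (fun x => f x * g x) := fun f g hf hg hgs => by
      have hgc : HasCompactSupport g := hc.mono' ((subset_tsupport g).trans hgs)
      refine Continuous.integrable_of_hasCompactSupport (continuous_of_tsupport fun x hx => ?_)
        hgc.mul_left
      have hxH := hs (hgs (tsupport_mul_subset_right hx))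
      exact (hf.continuousAt (isOpen_halfPlane.mem_nhds hxH)).mul hg.continuousAt
    have hdθ : Continuous (fun x => fderiv ℝ θ x v) :=
      (hθ.continuous_fderiv (by simp)).clm_apply continuous_const
    rw [setIntegral_eq_integral_of_forall_compl_eq_zero,
      setIntegral_eq_integral_of_forall_compl_eq_zero]
    · refine integral_mul_fderiv_eq_neg_fderiv_mul_of_integrable ?_ ?_ ?_ ?_ ?_
      · exact hint _ _ (hfd.clm_apply continuousOn_const) hθ.continuous subset_rfl
      · exact hint _ _ hcont hdθ (tsupport_fderiv_apply_subset ℝ v)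
      · exact hint _ _ hcont hθ.continuous subset_rfl
      · exact fun x hx => (hu x (hs hx)).differentiableAt (by simp)
      · exact fun x _ => hθ.differentiable (by simp) x
    · intro x hx
      rw [image_eq_zero_of_notMem_tsupport fun h => hx (hs h), mul_zero]
    · intro x hx
      rw [image_eq_zero_of_notMem_tsupport (f := fun x => fderiv ℝ θ x v) fun h =>
        hx (hs (tsupport_fderiv_apply_subset ℝ v h)), mul_zero]
  exact ⟨hcont.locallyIntegrableOn measurableSet_halfPlane, h1, h2, key (1, 0), key (0, 1)⟩

/-- A smooth function of the elliptic coordinates that decays with its gradient like `e^{-ξ}` and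
vanishes linearly at the boundary of the strip belongs to `𝒬`. -/
lemma memQ_comp_ellipticInv {U : ℝ × ℝ → ℝ} (hU : ContDiff ℝ ∞ U) {C : ℝ}
    (h0 : ∀ p ∈ D, |U p| ≤ C * (Real.exp (-p.1) * Real.sin p.2))
    (h1 : ∀ p ∈ D, |d1 U p| ≤ C * Real.exp (-p.1))
    (h2 : ∀ p ∈ D, |d2 U p| ≤ C * Real.exp (-p.1)) :
    MemQ (fun x => U (ellipticInv x)) (d1 fun x => U (ellipticInv x))
      (d2 fun x => U (ellipticInv x)) := by
  set u : ℝ × ℝ → ℝ := fun x => U (ellipticInv x) with hu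
  have hsmooth : ∀ x ∈ halfPlane, ContDiffAt ℝ ∞ u x := fun x hx =>
    hU.contDiffAt.comp x (contDiffAt_ellipticInv (halfPlane_subset_compl_slit hx))
  have hdiff : ∀ x ∈ halfPlane, DifferentiableAt ℝ u x := fun x hx =>
    (hsmooth x hx).differentiableAt (by simp)
  have hfd : ContinuousOn (fderiv ℝ u) halfPlane := fun x hx =>
    ((hsmooth x hx).fderiv_right (m := 0) (by simp)).continuousAt.continuousWithinAt
  have hm1 : AEStronglyMeasurable (d1 u) (volume.restrict halfPlane) :=
    (hfd.clm_apply continuousOn_const).aestronglyMeasurable measurableSet_halfPlane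
  have hm2 : AEStronglyMeasurable (d2 u) (volume.restrict halfPlane) :=
    (hfd.clm_apply continuousOn_const).aestronglyMeasurable measurableSet_halfPlane
  have huF : Set.EqOn (fun q => u (F q)) U D := fun q hq => by
    simp only [hu, ellipticInv_F (D_subset_strip hq)]
  have henergy : ∫⁻ x in halfPlane, ENNReal.ofReal (d1 u x ^ 2 + d2 u x ^ 2) < ⊤ := by
    rw [lintegral_energy_comp_F hdiff]
    refine (setLIntegral_mono' measurableSet_D fun p hp => ENNReal.ofReal_le_ofReal ?_).trans_lt
      (lintegral_exp_lt_top (C ^ 2 + C ^ 2))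
    rw [d1_congr isOpen_D huF hp, d2_congr isOpen_D huF hp]
    have hsq : Real.exp (-2 * p.1) = Real.exp (-p.1) ^ 2 := by
      rw [← Real.exp_nat_mul]; ring_nf
    rw [hsq, add_mul, ← mul_pow]
    exact add_le_add (sq_le_sq' (abs_le.1 (h1 p hp)).1 (abs_le.1 (h1 p hp)).2)
      (sq_le_sq' (abs_le.1 (h2 p hp)).1 (abs_le.1 (h2 p hp)).2)
  rw [lintegral_ofReal_sq_add_sq hm1, ENNReal.add_lt_top] at henergy
  have hg := hasWeakGradient_of_contDiffAt hsmooth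
    ⟨hm1, lt_of_not_ge fun h => by simp [top_le_iff.1 h] at henergy⟩
    ⟨hm2, lt_of_not_ge fun h => by simp [top_le_iff.1 h] at henergy⟩
  refine ⟨hg, fun n x => cutoff n (ellipticInv x) * U (ellipticInv x), isTest_cutoff hU, ?_⟩
  have ht := isTest_cutoff hU
  set φ : ℕ → ℝ × ℝ → ℝ := fun n x => cutoff n (ellipticInv x) * U (ellipticInv x) with hφ
  have herr : ∀ n, ∫⁻ p in D, ENNReal.ofReal (d1 (fun q => cutoff n q * U q - U q) p ^ 2 +
        d2 (fun q => cutoff n q * U q - U q) p ^ 2) =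
      eLpNorm (fun x => d1 (φ n) x - d1 u x) 2 (volume.restrict halfPlane) ^ 2 +
        eLpNorm (fun x => d2 (φ n) x - d2 u x) 2 (volume.restrict halfPlane) ^ 2 := fun n => by
    have heq : Set.EqOn (fun q => φ n (F q) - u (F q)) (fun q => cutoff n q * U q - U q) D :=
      fun q hq => by simp only [hφ, hu, ellipticInv_F (D_subset_strip hq)]
    rw [← lintegral_ofReal_sq_add_sq (f := fun x => d1 (φ n) x - d1 u x)
      ((ht n).memLp_d1.1.sub hm1)]
    trans ∫⁻ x in halfPlane, ENNReal.ofReal (d1 (fun x => φ n x - u x) x ^ 2 +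
      d2 (fun x => φ n x - u x) x ^ 2)
    · rw [lintegral_energy_comp_F (u := fun x => φ n x - u x) fun x hx =>
        ((ht n).differentiable x).sub (hdiff x hx)]
      refine setLIntegral_congr_fun measurableSet_D fun p hp => ?_
      rw [d1_congr isOpen_D heq hp, d2_congr isOpen_D heq hp]
    · refine setLIntegral_congr_fun measurableSet_halfPlane fun x hx => ?_
      rw [d1_sub ((ht n).differentiable x) (hdiff x hx),
        d2_sub ((ht n).differentiable x) (hdiff x hx)]
  have hlim := tendsto_energy_cutoff_error hU h0 h1 h2
  simp only [herr] at hlim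
  refine ⟨tendsto_zero_of_sq ?_, tendsto_zero_of_sq ?_, fun K hK hKH => ?_⟩
  · exact tendsto_of_tendsto_of_tendsto_of_le_of_le tendsto_const_nhds hlim (fun _ => zero_le)
      fun n => le_self_add
  · exact tendsto_of_tendsto_of_tendsto_of_le_of_le tendsto_const_nhds hlim (fun _ => zero_le)
      fun n => le_add_self
  -- On a compact set the cut-off is eventually equal to `1`.
  · refine tendsto_const_nhds.congr' ?_
    rcases K.eq_empty_or_nonempty with rfl | hne
    · simp
    have hcont : ContinuousOn ellipticInv K :=
      continuousOn_ellipticInv.mono (hKH.trans halfPlane_subset_compl_slit)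
    obtain ⟨y, hyK, hy⟩ := hK.exists_isMaxOn hne (continuous_fst.comp_continuousOn hcont)
    obtain ⟨z, hzK, hz⟩ := hK.exists_isMinOn hne
      ((Real.continuous_sin.comp continuous_snd).comp_continuousOn hcont)
    have hz0 : 0 < Real.sin (ellipticInv z).2 :=
      sin_pos_of_mem_strip (D_subset_strip (ellipticInv_mem_D (hKH hzK)))
    obtain ⟨N, hN⟩ := exists_nat_gt
      (max ((ellipticInv y).1 + 1) (2 / Real.sin (ellipticInv z).2))
    filter_upwards [eventually_ge_atTop N] with n hn
    have hnN : (N : ℝ) ≤ n := by exact_mod_cast hn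
    have hone : ∀ x ∈ K, φ n x - u x = 0 := fun x hx => by
      have hx1 : 0 < (ellipticInv x).1 := (ellipticInv_mem_D (hKH hx)).1
      have hxy : (ellipticInv x).1 ≤ (ellipticInv y).1 := hy hx
      have hxz : Real.sin (ellipticInv z).2 ≤ Real.sin (ellipticInv x).2 := hz hx
      have a1 : 1 ≤ n - (ellipticInv x).1 := by
        linarith [le_max_left ((ellipticInv y).1 + 1) (2 / Real.sin (ellipticInv z).2)]
      have a2 : 1 ≤ n * Real.sin (ellipticInv x).2 - 1 := by
        have h := le_max_right ((ellipticInv y).1 + 1) (2 / Real.sin (ellipticInv z).2)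
        have h' : 2 / Real.sin (ellipticInv z).2 < n := by linarith
        rw [div_lt_iff₀ hz0] at h'
        have := mul_le_mul_of_nonneg_left hxz (Nat.cast_nonneg (α := ℝ) n)
        linarith
      simp only [hφ, hu, cutoff]
      rw [Real.smoothTransition.one_of_one_le a1, Real.smoothTransition.one_of_one_le a2,
        Real.smoothTransition.one_of_one_le (x := (ellipticInv x).1 + 2) (by linarith)]
      ring
    have : (fun x => φ n x - u x) =ᵐ[volume.restrict K] fun _ => 0 := by
      filter_upwards [ae_restrict_mem hK.measurableSet] with x hx
      exact hone x hx
    rw [eLpNorm_congr_ae this]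
    simp

/-! ### The boundary datum -/

/-- `ψ_k` is the imaginary part of `z^k`. -/
lemma psi_eq_im_pow (k : ℕ) (x : ℝ × ℝ) :
    psi k x = (((x.1 : ℂ) + x.2 * Complex.I) ^ k).im := by
  have hz : (⟨x.1, x.2⟩ : ℂ) = (x.1 : ℂ) + x.2 * Complex.I := Complex.mk_eq_add_mul_I _ _
  rw [psi, hz]
  set z : ℂ := (x.1 : ℂ) + x.2 * Complex.I with hzdef
  conv_rhs => rw [← Complex.norm_mul_exp_arg_mul_I z, mul_pow, ← Complex.exp_nat_mul]
  have e : (k : ℂ) * (z.arg * Complex.I) = ((k * z.arg : ℝ) : ℂ) * Complex.I := by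
    push_cast; ring
  rw [e, ← Complex.ofReal_pow, Complex.im_ofReal_mul, Complex.exp_ofReal_mul_I_im]

lemma normalDerivPsi_eq (k : ℕ) (t : ℝ) : normalDerivPsi k t = -(k * t ^ (k - 1)) := by
  have hline : HasDerivAt (fun y : ℝ => (t : ℂ) + (y : ℂ) * Complex.I) Complex.I 0 := by
    simpa using
      ((Complex.ofRealCLM.hasDerivAt (x := (0 : ℝ))).mul_const Complex.I).const_add (t : ℂ)
  have hpow := hline.fun_pow k
  have him : HasDerivAt (fun y : ℝ => (((t : ℂ) + (y : ℂ) * Complex.I) ^ k).im)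
      (k * t ^ (k - 1)) 0 := by
    refine (Complex.imCLM.hasFDerivAt.comp_hasDerivAt (0 : ℝ) hpow).congr_deriv ?_
    simp only [Complex.ofReal_zero, zero_mul, add_zero, Complex.imCLM_apply]
    have e : (k : ℂ) * (t : ℂ) ^ (k - 1) * Complex.I =
        ((k * t ^ (k - 1) : ℝ) : ℂ) * Complex.I := by push_cast; ring
    rw [e, Complex.im_ofReal_mul, Complex.I_im, mul_one]
  have hpsi : (fun y : ℝ => psi k (t, y)) =
      fun y : ℝ => (((t : ℂ) + (y : ℂ) * Complex.I) ^ k).im :=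
    funext fun y => psi_eq_im_pow k (t, y)
  rw [normalDerivPsi, hpsi, him.hasDerivWithinAt.derivWithin (uniqueDiffWithinAt_Ici 0)]

/-- The expansion of `cos^k` in multiple angles. -/
lemma two_pow_mul_cos_pow (k : ℕ) (y : ℝ) :
    2 ^ k * Real.cos y ^ k =
      ∑ j ∈ Finset.range (k + 1), (k.choose j : ℝ) * Real.cos (((k : ℝ) - 2 * j) * y) := by
  have h : ((2 : ℂ) * Complex.cos y) ^ k = ∑ j ∈ Finset.range (k + 1),
      (k.choose j : ℂ) * Complex.exp (((((k : ℝ) - 2 * j) * y : ℝ) : ℂ) * Complex.I) := by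
    rw [Complex.two_cos, add_comm, add_pow]
    refine Finset.sum_congr rfl fun j hj => ?_
    have hjk : j ≤ k := Nat.lt_succ_iff.1 (Finset.mem_range.1 hj)
    rw [← Complex.exp_nat_mul, ← Complex.exp_nat_mul, ← Complex.exp_add, mul_comm]
    congr 2
    push_cast [Nat.cast_sub hjk]
    ring
  have h' := congrArg Complex.re h
  rw [← mul_pow]
  have hl : ((2 : ℂ) * Complex.cos y) ^ k = (((2 * Real.cos y) ^ k : ℝ) : ℂ) := by push_cast; rfl
  rw [hl, Complex.ofReal_re, Complex.re_sum] at h'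
  rw [h']
  refine Finset.sum_congr rfl fun j _ => ?_
  rw [← Complex.ofReal_natCast, Complex.re_ofReal_mul, Complex.exp_ofReal_mul_I_re]

/-- Folding a sum that is symmetric under `j ↦ k - j` with vanishing middle term. -/
lemma sum_range_eq_two_mul_of_symm {k : ℕ} (hk : 1 ≤ k) {h : ℕ → ℝ}
    (hsymm : ∀ j ≤ k, h (k - j) = h j) (hmid : ∀ j, 2 * j = k → h j = 0) :
    ∑ j ∈ Finset.range (k + 1), h j = 2 * ∑ j ∈ Finset.range ((k - 1) / 2 + 1), h j := by
  rcases Nat.even_or_odd' k with ⟨a, rfl | rfl⟩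
  · have e1 : (2 * a - 1) / 2 + 1 = a := by omega
    have e2 : 2 * a + 1 = a + (a + 1) := by omega
    rw [e1, e2, Finset.sum_range_add, Finset.sum_range_succ', add_zero, hmid a rfl, add_zero,
      two_mul]
    congr 1
    rw [← Finset.sum_range_reflect]
    refine Finset.sum_congr rfl fun j hj => ?_
    have hj := Finset.mem_range.1 hj
    rw [← hsymm j (by omega)]
    congr 1
    omega
  · have e1 : (2 * a + 1 - 1) / 2 + 1 = a + 1 := by omega
    have e2 : 2 * a + 1 + 1 = (a + 1) + (a + 1) := by omega
    rw [e1, e2, Finset.sum_range_add, two_mul]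
    congr 1
    rw [← Finset.sum_range_reflect]
    refine Finset.sum_congr rfl fun j hj => ?_
    have hj := Finset.mem_range.1 hj
    rw [← hsymm j (by omega)]
    congr 1
    omega

/-- The derivative of the expansion of `cos^k` in multiple angles. -/
lemma mul_cos_pow_mul_sin {k : ℕ} (hk : 1 ≤ k) (y : ℝ) :
    k * Real.cos y ^ (k - 1) * Real.sin y = 1 / 2 ^ (k - 1) *
      ∑ j ∈ Finset.range ((k - 1) / 2 + 1),
        (k.choose j : ℝ) * (((k : ℝ) - 2 * j) * Real.sin (((k : ℝ) - 2 * j) * y)) := by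
  have hL : HasDerivAt (fun y => 2 ^ k * Real.cos y ^ k)
      (2 ^ k * (k * Real.cos y ^ (k - 1) * -Real.sin y)) y :=
    ((Real.hasDerivAt_cos y).fun_pow k).const_mul (2 ^ k)
  have hR : HasDerivAt (fun y => ∑ j ∈ Finset.range (k + 1),
      (k.choose j : ℝ) * Real.cos (((k : ℝ) - 2 * j) * y))
      (∑ j ∈ Finset.range (k + 1), (k.choose j : ℝ) *
        (-Real.sin (((k : ℝ) - 2 * j) * y) * ((k : ℝ) - 2 * j))) y :=
    HasDerivAt.fun_sum fun j _ => by
      simpa using! (((hasDerivAt_id y).const_mul ((k : ℝ) - 2 * j)).cos).const_mul (k.choose j : ℝ)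
  rw [← funext (two_pow_mul_cos_pow k)] at hR
  have h := hL.unique hR
  have hs := sum_range_eq_two_mul_of_symm hk
    (h := fun j => (k.choose j : ℝ) * (((k : ℝ) - 2 * j) * Real.sin (((k : ℝ) - 2 * j) * y)))
    (fun j hj => by
      have e : (k : ℝ) - 2 * ((k - j : ℕ) : ℝ) = -((k : ℝ) - 2 * j) := by
        rw [Nat.cast_sub hj]; ring
      simp only [e, Nat.choose_symm hj, neg_mul, Real.sin_neg]
      ring)
    (fun j hj => by
      have e : (k : ℝ) - 2 * j = 0 := by rw [← hj]; push_cast; ring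
      simp [e])
  have hneg : ∑ j ∈ Finset.range (k + 1), (k.choose j : ℝ) *
        (-Real.sin (((k : ℝ) - 2 * j) * y) * ((k : ℝ) - 2 * j)) =
      -∑ j ∈ Finset.range (k + 1), (k.choose j : ℝ) *
        (((k : ℝ) - 2 * j) * Real.sin (((k : ℝ) - 2 * j) * y)) := by
    rw [← Finset.sum_neg_distrib]
    exact Finset.sum_congr rfl fun j _ => by ring
  rw [hneg, hs] at h
  obtain ⟨l, rfl⟩ : ∃ l, k = l + 1 := ⟨k - 1, by omega⟩
  have h2 : (2 : ℝ) ^ l ≠ 0 := by positivity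
  rw [one_div, eq_inv_mul_iff_mul_eq₀ (by simp)]
  simp only [Nat.add_sub_cancel] at h ⊢
  rw [pow_succ] at h
  linarith

/-! ### Green's formula in the half-strip -/

/-- Green's formula for a decaying harmonic sum `U` on `D`, with a function that vanishes on the
lateral boundary and for large `ξ`: only the side `ξ = 0` contributes. -/
lemma integral_dirichlet_sinSum (s : Finset ℕ) (m : ℕ → ℕ) (c : ℕ → ℝ) {Φ : ℝ × ℝ → ℝ}
    (hΦ : ContDiff ℝ ∞ Φ) (h0 : ∀ ξ, Φ (ξ, 0) = 0) (hpi : ∀ ξ, Φ (ξ, Real.pi) = 0) {R : ℝ}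
    (hR : 0 < R) (hfar : ∀ p ∈ strip, R ≤ p.1 → Φ p = 0) :
    ∫ p in D, (d1 (sinSum s m c) p * d1 Φ p + d2 (sinSum s m c) p * d2 Φ p) =
      ∫ η in 0..Real.pi, sinSum s m (fun j => m j * c j) (0, η) * Φ (0, η) := by
  have cU1 := continuous_d1 (contDiff_sinSum s m c)
  have cU2 := continuous_d2 (contDiff_sinSum s m c)
  have c1 := continuous_d1 hΦ
  have c2 := continuous_d2 hΦ
  have cont : Continuous
      (fun p => d1 (sinSum s m c) p * d1 Φ p + d2 (sinSum s m c) p * d2 Φ p) := by fun_prop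
  have hopen : IsOpen (strip ∩ {p | R < p.1}) :=
    isOpen_strip.inter (isOpen_lt continuous_const continuous_fst)
  have hzero : Set.EqOn Φ (fun _ => 0) (strip ∩ {p | R < p.1}) := fun p hp =>
    hfar p hp.1 (le_of_lt hp.2)
  have hsub : Set.Ioc 0 R ×ˢ Set.Ioo 0 Real.pi ⊆ D :=
    Set.prod_mono Set.Ioc_subset_Ioi_self subset_rfl
  rw [setIntegral_eq_of_subset_of_forall_sdiff_eq_zero measurableSet_D hsub fun p hp => by
    have hlt : R < p.1 := by
      by_contra! h
      exact hp.2 ⟨⟨hp.1.1, h⟩, hp.1.2⟩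
    have hmem : p ∈ strip ∩ {p | R < p.1} := ⟨D_subset_strip hp.1, hlt⟩
    rw [d1_congr hopen hzero hmem, d2_congr hopen hzero hmem]
    simp [d1, d2]]
  have hint : ∀ A B : Set ℝ, A ⊆ Set.Icc 0 R → B ⊆ Set.Icc 0 Real.pi → IntegrableOn
      (fun p => d1 (sinSum s m c) p * d1 Φ p + d2 (sinSum s m c) p * d2 Φ p) (A ×ˢ B) :=
    fun A B hA hB => (cont.continuousOn.integrableOn_compact
      (isCompact_Icc.prod isCompact_Icc)).mono_set (Set.prod_mono hA hB)
  have hprod := setIntegral_prod (μ := (volume : Measure ℝ)) (ν := (volume : Measure ℝ)) _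
    (hint _ _ Set.Ioc_subset_Icc_self Set.Ioo_subset_Icc_self)
  rw [← Measure.volume_eq_prod] at hprod
  rw [hprod]
  simp only [← integral_Ioc_eq_integral_Ioo, ← intervalIntegral.integral_of_le Real.pi_pos.le,
    ← intervalIntegral.integral_of_le hR.le]
  have hdΦ : ∀ p, HasFDerivAt Φ (fderiv ℝ Φ p) p := fun p =>
    (hΦ.differentiable (by simp) p).hasFDerivAt
  have hdiv := integral2_divergence_prod_of_hasFDerivAt
    (fun p => -sinSum s m (fun j => m j * c j) p * Φ p)
    (fun p => cosSum s m (fun j => m j * c j) p * Φ p) _ _ 0 0 R Real.pi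
    ((contDiff_sinSum _ _ _).continuous.neg.mul hΦ.continuous).continuousOn
    ((contDiff_cosSum _ _ _).continuous.mul hΦ.continuous).continuousOn
    (fun p _ => (hasFDerivAt_sinSum s m (fun j => m j * c j) p).neg.mul (hdΦ p))
    (fun p _ => (hasFDerivAt_cosSum s m (fun j => m j * c j) p).mul (hdΦ p))
  -- The divergence is the Dirichlet integrand since the modes are harmonic.
  have heq : ∀ p : ℝ × ℝ,
      ((-sinSum s m (fun j => m j * c j) p) • fderiv ℝ Φ p + Φ p •
        -(-sinSum s m (fun j => m j * (m j * c j)) p • ContinuousLinearMap.fst ℝ ℝ ℝ +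
          cosSum s m (fun j => m j * (m j * c j)) p • ContinuousLinearMap.snd ℝ ℝ ℝ)) (1, 0) +
      (cosSum s m (fun j => m j * c j) p • fderiv ℝ Φ p + Φ p •
        (-cosSum s m (fun j => m j * (m j * c j)) p • ContinuousLinearMap.fst ℝ ℝ ℝ -
          sinSum s m (fun j => m j * (m j * c j)) p • ContinuousLinearMap.snd ℝ ℝ ℝ)) (0, 1) =
      d1 (sinSum s m c) p * d1 Φ p + d2 (sinSum s m c) p * d2 Φ p := fun p => by
    rw [d1_sinSum, d2_sinSum]
    simp [d1, d2]
    ring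
  have hdiv' := hdiv (by
    simp only [Pi.neg_apply, heq]
    rw [Set.uIcc_of_le hR.le, Set.uIcc_of_le Real.pi_pos.le]
    exact hint _ _ subset_rfl subset_rfl)
  simp only [Pi.neg_apply, heq] at hdiv'
  have hend : ∀ η ∈ Set.uIcc 0 Real.pi, Φ (R, η) = 0 := fun η hη => by
    rw [Set.uIcc_of_le Real.pi_pos.le] at hη
    rcases hη.1.eq_or_lt with h | h
    · rw [← h, h0]
    rcases hη.2.eq_or_lt with h' | h'
    · rw [h', hpi]
    · exact hfar _ ⟨h, h'⟩ le_rfl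
  have hR0 : ∫ η in 0..Real.pi, -sinSum s m (fun j => m j * c j) (R, η) * Φ (R, η) = 0 := by
    rw [intervalIntegral.integral_congr (g := fun _ => 0) fun η hη => by simp [hend η hη]]
    simp
  rw [hdiv', hR0]
  simp only [h0, hpi, mul_zero, intervalIntegral.integral_zero, sub_zero, zero_add, zero_sub,
    neg_mul, intervalIntegral.integral_neg, neg_neg]

/-! ### Existence -/

/-- The frequencies `k - 2j` of the modes of `W k`. -/
def freq (k j : ℕ) : ℕ := k - 2 * j

/-- The coefficients of the modes of `W k`. -/
def coeff (k j : ℕ) : ℝ := 1 / 2 ^ (k - 1) * k.choose j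

lemma freq_spec {k j : ℕ} (hk : 1 ≤ k) (hj : j ∈ Finset.range ((k - 1) / 2 + 1)) :
    1 ≤ freq k j ∧ (freq k j : ℝ) = k - 2 * j := by
  have hj := Finset.mem_range.1 hj
  have h : 2 * j ≤ k := by omega
  refine ⟨by unfold freq; omega, ?_⟩
  rw [freq, Nat.cast_sub h]
  push_cast
  ring

lemma W_eq_sinSum {k : ℕ} (hk : 1 ≤ k) :
    W k = sinSum (Finset.range ((k - 1) / 2 + 1)) (freq k) (coeff k) := by
  ext p
  rw [W, sinSum, Finset.mul_sum]
  refine Finset.sum_congr rfl fun j hj => ?_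
  rw [(freq_spec hk hj).2, coeff]
  ring

/-- The normal derivative `-∂W/∂ξ` on the side `ξ = 0`, which is mapped to `Γ₁`. -/
lemma sinSum_freq_coeff {k : ℕ} (hk : 1 ≤ k) (η : ℝ) :
    sinSum (Finset.range ((k - 1) / 2 + 1)) (freq k) (fun j => freq k j * coeff k j) (0, η) =
      k * Real.cos η ^ (k - 1) * Real.sin η := by
  rw [mul_cos_pow_mul_sin hk, sinSum, Finset.mul_sum]
  refine Finset.sum_congr rfl fun j hj => ?_
  rw [(freq_spec hk hj).2, coeff]
  simp only [mul_zero, Real.exp_zero, one_mul]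
  ring

lemma memQ_W {k : ℕ} (hk : 1 ≤ k) :
    MemQ (fun x => W k (ellipticInv x)) (d1 fun x => W k (ellipticInv x))
      (d2 fun x => W k (ellipticInv x)) := by
  rw [W_eq_sinSum hk]
  have hm : ∀ j ∈ Finset.range ((k - 1) / 2 + 1), 1 ≤ freq k j := fun j hj => (freq_spec hk hj).1
  refine memQ_comp_ellipticInv (contDiff_sinSum _ _ _) (C := ∑ j ∈ Finset.range ((k - 1) / 2 + 1),
    |freq k j * coeff k j|) (fun p hp => ?_) (fun p hp => ?_) (fun p hp => ?_)
  · have h := abs_sinSum_le_mul_sin hm (coeff k) (le_of_lt hp.1)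
    rwa [abs_of_pos (sin_pos_of_mem_strip (D_subset_strip hp))] at h
  · rw [d1_sinSum, abs_neg]
    exact abs_sinSum_le hm _ (le_of_lt hp.1)
  · rw [d2_sinSum]
    exact abs_cosSum_le hm _ (le_of_lt hp.1)

theorem isWeakSolution_W {k : ℕ} (hk : 1 ≤ k) :
    IsWeakSolution k (fun x => W k (ellipticInv x)) := by
  refine ⟨_, _, memQ_W hk, fun φ hφ => ?_⟩
  have hsmooth : ContDiff ℝ ∞ (W k) := by
    rw [W_eq_sinSum hk]
    exact contDiff_sinSum _ _ _
  have hdiff : ∀ x ∈ halfPlane, DifferentiableAt ℝ (fun x => W k (ellipticInv x)) x := fun x hx =>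
    (hsmooth.contDiffAt.comp x
      (contDiffAt_ellipticInv (halfPlane_subset_compl_slit hx))).differentiableAt (by simp)
  have hWF : Set.EqOn (fun q => W k (ellipticInv (F q))) (W k) D := fun q hq => by
    simp only [ellipticInv_F (D_subset_strip hq)]
  have hslit : ∀ x ∈ slit, φ x = 0 := fun x hx =>
    image_eq_zero_of_notMem_tsupport fun h => Set.disjoint_left.1 hφ.disjoint_slit h hx
  -- The test function vanishes for `ξ ≥ R`.
  obtain ⟨K, -, hK, hKφ⟩ := hφ.exists_compact
  obtain ⟨R, hR0, hR⟩ : ∃ R : ℝ, 0 < R ∧ ∀ p ∈ K, p.1 < R := by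
    obtain ⟨B, hB⟩ := (hK.image continuous_fst).bddAbove
    refine ⟨max B 0 + 1, by positivity, fun p hp => ?_⟩
    have := hB (Set.mem_image_of_mem Prod.fst hp)
    linarith [le_max_left B 0]
  have hgreen := integral_dirichlet_sinSum (Finset.range ((k - 1) / 2 + 1)) (freq k) (coeff k)
    (Φ := fun q => φ (F q)) (hφ.smooth.comp contDiff_F)
    (fun ξ => hslit _ ⟨by simp [F], Or.inl (by simp [F])⟩)
    (fun ξ => hslit _ ⟨by simp [F], Or.inr (by simp [F])⟩) hR0
    (fun p hp hRp => hKφ p hp fun h => absurd (hR p h) (not_lt.2 hRp))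
  rw [integral_dirichlet_comp_F hdiff fun x _ => hφ.differentiable x]
  trans ∫ p in D, (d1 (W k) p * d1 (fun q => φ (F q)) p + d2 (W k) p * d2 (fun q => φ (F q)) p)
  · refine setIntegral_congr_fun measurableSet_D fun p hp => ?_
    simp only [d1_congr isOpen_D hWF hp, d2_congr isOpen_D hWF hp]
  rw [W_eq_sinSum hk, hgreen]
  simp only [sinSum_freq_coeff hk, normalDerivPsi_eq, neg_neg]
  have hφc : Continuous φ := hφ.smooth.continuous
  have hsubst := intervalIntegral.integral_comp_mul_deriv (a := 0) (b := Real.pi)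
    (f := Real.cos) (f' := fun η => -Real.sin η) (g := fun t => k * t ^ (k - 1) * φ (t, 0))
    (fun η _ => Real.hasDerivAt_cos η) (by fun_prop) (by fun_prop)
  rw [Real.cos_zero, Real.cos_pi, intervalIntegral.integral_symm (-1) 1] at hsubst
  refine Eq.trans ?_ (neg_eq_iff_eq_neg.2 hsubst)
  rw [← intervalIntegral.integral_neg]
  refine intervalIntegral.integral_congr fun η _ => ?_
  simp [F]
  ring

end EllipticProfile

end

theorem proposition3p3 (k : ℕ) (hk : 1 ≤ k) :
    ∃ w : ℝ × ℝ → ℝ,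
      EllipticProfile.IsWeakSolution k w ∧
      (∀ v : ℝ × ℝ → ℝ, EllipticProfile.IsWeakSolution k v →
        v =ᵐ[volume.restrict EllipticProfile.halfPlane] w) ∧
      ∀ p ∈ EllipticProfile.D, w (EllipticProfile.F p) = EllipticProfile.W k p := by
  refine ⟨fun x => EllipticProfile.W k (EllipticProfile.ellipticInv x),
    EllipticProfile.isWeakSolution_W hk,
    fun v hv => hv.ae_eq (EllipticProfile.isWeakSolution_W hk), fun p hp => ?_⟩
  simp only [EllipticProfile.ellipticInv_F (EllipticProfile.D_subset_strip hp)]
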